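/- Let $F=f+\psi$ on $\mathbb R^n$, where $f:\mathbb R^n\to\mathbb R$ is convex and differentiable and $\psi(x)=\sum_{i=1}^n\psi^i(x^i)$ with each $\psi^i:\mathbb R\to\mathbb R\cup\{+\infty\}$ closed and convex. For a vector $v$ with positive entries write $\|x\|_v^2=\sum_i v_i(x^i)^2$. Let $x_*$ minimize $F$, and suppose that for some $\mu_F(v)>0$ one has $F(x)\ge F(x_*)+\frac{\mu_F(v)}2\|x-x_*\|_v^2$ for all $x$. Let $\hat S\subset\{1,\dots,n\}$ be a random set such that $\mathbf P(i\in\hat S)$ does not depend on $i$ and $\tau:=\mathbf E|\hat S|>0$, and suppose that $(f,\hat S)\sim\mathrm{ESO}(v)$, i.e. $\mathbf E[f(x+h_{[\hat S]})]\le f(x)+\frac\tau n\big(\langle\nabla f(x),h\rangle+\frac12\|h\|_v^2\big)$ for all $x,h\in\mathbb R^n$, where $h_{[S]}=\sum_{i\in S}h^ie_i$. Put $\theta_0=\tau/n$, $\theta_{k+1}=\frac12\big(\sqrt{\theta_k^4+4\theta_k^2}-\theta_k^2\big)$, and by convention $1/\theta_{-1}^2:=(1-\theta_0)/\theta_0^2$.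 Define $\gamma_0^0=1$, $\gamma_1^0=0$, $\gamma_1^1=1$ and, for $k\ge1$, $\gamma_{k+1}^i=(1-\theta_k)\gamma_k^i$ for $i<k$, $\gamma_{k+1}^k=\theta_k(1-\frac n\tau\theta_{k-1})+\frac n\tau(\theta_{k-1}-\theta_k)$, $\gamma_{k+1}^{k+1}=\frac n\tau\theta_k$. For $k\ge1$ let $c_k=\frac1{\theta_0\theta_{k-1}}-\frac{1-\theta_0}{\theta_0^2}$, $W_k=\sum_{i=0}^{k-1}\frac{\gamma_k^i}{\theta_{i-1}^2}+c_k$ and $m_k(\mu)=\frac{\mu\theta_0^2}{1+\mu(1-\theta_0)}W_k$. APPROX with independent sets $S_0,S_1,\dots$ distributed as $\hat S$ starts at $z_0=x_0$ with $F(x_0)<+\infty$, and in iteration $k$ sets $y_k=(1-\theta_k)x_k+\theta_kz_k$, $$z_{k+1}^i=\arg\min_{t\in\mathbb R}\Big\{\nabla_if(y_k)(t-y_k^i)+\tfrac{\theta_knv_i}{2\tau}(t-z_k^i)^2+\psi^i(t)\Big\}\ (i\in S_k),\qquad z_{k+1}^i=z_k^i\ (i\notin S_k),$$ and $x_{k+1}=y_k+\frac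 n\tau\theta_k(z_{k+1}-z_k)$. Restarted APPROX with period $K$ and parameter $\sigma$ additionally restarts at the end of each iteration $k$ with $k\equiv0\pmod K$ (or, in the other indexing convention, at the end of each iteration $k$ with $k+1\equiv0\pmod K$; the result holds for both). A restart replaces $x_{k+1}$ and $z_{k+1}$ by $\bar x=\sigma X_j+(1-\sigma)\mathring x$ and the current $\theta$ by $\theta_0$. Here $X_0,\dots,X_j$ are the iterates $x$ produced since the previous restart (or since the start), $X_0$ being the point at which that run began, and $\mathring x=\frac1{W_j}\Big(\sum_{i=0}^{j-1}\frac{\gamma_j^i}{\theta_{i-1}^2}X_i+c_jX_j\Big)$; within a run, the sequence $\theta$ is indexed from $0$. Let $\mu\in(0,1]$, $K=\Big\lceil\frac{2\sqrt3}{\theta_0}\sqrt{1+\frac1\mu}-\frac2{\theta_0}+1\Big\rceil$, $\sigma=\frac1{1+m_K(\mu)}$, and $D(x)=(1-\theta_0)(F(x)-F(x_*))+\frac12\|x-x_*\|_v^2$. Then for every $\epsilon>0$ and every integer $k\ge0$ with $$k\ \ge\ N(\epsilon):=\frac n\tau\left(6\sqrt6\,\max\Big(\frac1{\sqrt\mu},\frac{\sqrt\mu}{\mu_F(v)}\Big)\log\frac{D(x_0)}\epsilon+2\sqrt3\sqrt{1+\frac1\mu}\right)$$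 the iterate $x_k$ of restarted APPROX satisfies $F(x_k)<+\infty$ and $$\mathbf E\Big[(1-\theta_0)(F(x_k)-F(x_*))+\tfrac12\|x_k-x_*\|_v^2\Big]\le\epsilon .$$ (If $x_0=x_*$, the logarithm is read as $0$.) Moreover $N(\epsilon)=O\big(\frac n\tau\max(\frac1{\sqrt\mu},\frac{\sqrt\mu}{\mu_F(v)})\log\frac1\epsilon\big)$, where $O$ hides a universal constant and a logarithm of the problem-dependent constant $D(x_0)$. Precisely, there is a universal constant $C>0$ such that, for all problems and parameters as above, $$N(\epsilon)\le C\,\frac n\tau\max\Big(\frac1{\sqrt\mu},\frac{\sqrt\mu}{\mu_F(v)}\Big)\Big(\log\frac1\epsilon+\max(0,\log D(x_0))\Big)\qquad(0<\epsilon\le\tfrac12),$$ where $\log D(x_0)$ is again read as $0$ if $D(x_0)=0$, and $|N(\epsilon)|\le C\,\frac n\tau\max\big(\frac1{\sqrt\mu},\frac{\sqrt\mu}{\mu_F(v)}\big)\log\frac1\epsilon$ for all sufficiently small $\epsilon>0$ (depending on the problem). -/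

import Mathlib

open MeasureTheory ProbabilityTheory Filter Topology Asymptotics

noncomputable section

/-! ### The composite problem -/

/-- A function `g : ℝ → ℝ ∪ {+∞}` is closed and convex: its epigraph is closed and convex. -/
def IsClosedConvex (g : ℝ → WithTop ℝ) : Prop :=
  IsClosed {p : ℝ × ℝ | g p.1 ≤ (p.2 : WithTop ℝ)} ∧
    Convex ℝ {p : ℝ × ℝ | g p.1 ≤ (p.2 : WithTop ℝ)}

/-- The separable function `ψ(x) = ∑ i, ψ i (x i)` with values in `ℝ ∪ {+∞}`. -/
def separableSum {n : ℕ} (ψ : Fin n → ℝ → WithTop ℝ) (x : EuclideanSpace ℝ (Fin n)) :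
    WithTop ℝ :=
  ∑ i, ψ i (x i)

/-- The composite objective `F(x) = f(x) + ∑ i, ψ i (x i)`, with values in `ℝ ∪ {+∞}`. -/
def objective {n : ℕ} (f : EuclideanSpace ℝ (Fin n) → ℝ) (ψ : Fin n → ℝ → WithTop ℝ)
    (x : EuclideanSpace ℝ (Fin n)) : WithTop ℝ :=
  (f x : WithTop ℝ) + separableSum ψ x

/-- The squared weighted Euclidean norm `‖x‖_v² = ∑ i, v i * (x i)²`. -/
def weightedSq {n : ℕ} (v : Fin n → ℝ) (x : EuclideanSpace ℝ (Fin n)) : ℝ :=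
  ∑ i, v i * (x i) ^ 2

/-- The real number `F(x) - F(y)`, meaningful where `F(x)` and `F(y)` are finite. -/
def objectiveGap {n : ℕ} (f : EuclideanSpace ℝ (Fin n) → ℝ) (ψ : Fin n → ℝ → WithTop ℝ)
    (x y : EuclideanSpace ℝ (Fin n)) : ℝ :=
  (objective f ψ x).untopD 0 - (objective f ψ y).untopD 0

/-- The potential `D(x) = (1 - θ₀) (F(x) - F(x⋆)) + ½ ‖x - x⋆‖_v²`. -/
def potential {n : ℕ} (f : EuclideanSpace ℝ (Fin n) → ℝ) (ψ : Fin n → ℝ → WithTop ℝ)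
    (v : Fin n → ℝ) (θ₀ : ℝ) (xs x : EuclideanSpace ℝ (Fin n)) : ℝ :=
  (1 - θ₀) * objectiveGap f ψ x xs + 1 / 2 * weightedSq v (x - xs)

/-! ### Samplings and expected separable overapproximation -/

/-- The mean `τ = E[|Ŝ|]` of the number of coordinates in a random set with law `q`. -/
def expectedSize {n : ℕ} (q : PMF (Finset (Fin n))) : ℝ :=
  ∑ T, (q T).toReal * (T.card : ℝ)

/-- All coordinates are equally likely to be selected: `P(i ∈ Ŝ) = P(j ∈ Ŝ)`. -/
def IsUniformSampling {n : ℕ} (q : PMF (Finset (Fin n))) : Prop :=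
  ∀ i j : Fin n, ∑ T with i ∈ T, q T = ∑ T with j ∈ T, q T

/-- `h_[T] = ∑ i ∈ T, h i • e i`. -/
def restrictTo {n : ℕ} (T : Finset (Fin n)) (h : EuclideanSpace ℝ (Fin n)) :
    EuclideanSpace ℝ (Fin n) :=
  WithLp.toLp 2 fun i => if i ∈ T then h i else 0

/-- `(f, Ŝ) ∼ ESO(v)`, where `q` is the law of `Ŝ`:
`E[f(x + h_[Ŝ])] ≤ f(x) + (τ/n) (⟨∇f(x), h⟩ + ½ ‖h‖_v²)` for all `x` and `h`. -/
def ESO {n : ℕ} (f : EuclideanSpace ℝ (Fin n) → ℝ) (q : PMF (Finset (Fin n)))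
    (v : Fin n → ℝ) : Prop :=
  ∀ x h : EuclideanSpace ℝ (Fin n),
    ∑ T, (q T).toReal * f (x + restrictTo T h) ≤
      f x + expectedSize q / n * (inner ℝ (gradient f x) h + 1 / 2 * weightedSq v h)

/-! ### Coefficients -/

/-- `θ_{k+1} = (√(θ_k⁴ + 4 θ_k²) - θ_k²) / 2`, started at `θ₀`. -/
def thetaSeq (θ₀ : ℝ) : ℕ → ℝ
  | 0 => θ₀
  | k + 1 => (Real.sqrt (thetaSeq θ₀ k ^ 4 + 4 * thetaSeq θ₀ k ^ 2) - thetaSeq θ₀ k ^ 2) / 2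

/-- The number written `1 / θ_{i-1}²`; for `i = 0` it is `(1 - θ₀) / θ₀²` by convention. -/
def invThetaPrevSq (θ₀ : ℝ) : ℕ → ℝ
  | 0 => (1 - θ₀) / θ₀ ^ 2
  | i + 1 => 1 / thetaSeq θ₀ i ^ 2

/-- The coefficients `γ_k^i` (first argument `k`, second argument `i`), with `n/τ = 1/θ₀`. -/
def gammaCoeff (θ₀ : ℝ) : ℕ → ℕ → ℝ
  | 0, i => if i = 0 then 1 else 0
  | 1, i => if i = 1 then 1 else 0
  | k + 2, i =>
    if i ≤ k then (1 - thetaSeq θ₀ (k + 1)) * gammaCoeff θ₀ (k + 1) i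
    else if i = k + 1 then
      thetaSeq θ₀ (k + 1) * (1 - 1 / θ₀ * thetaSeq θ₀ k)
        + 1 / θ₀ * (thetaSeq θ₀ k - thetaSeq θ₀ (k + 1))
    else if i = k + 2 then 1 / θ₀ * thetaSeq θ₀ (k + 1)
    else 0

/-- The weight `1/(θ₀ θ_{k-1}) - (1 - θ₀)/θ₀²` of the last iterate, for `k ≥ 1`. -/
def lastWeight (θ₀ : ℝ) (k : ℕ) : ℝ :=
  1 / (θ₀ * thetaSeq θ₀ (k - 1)) - (1 - θ₀) / θ₀ ^ 2

/-- The total weight `∑_{i<k} γ_k^i/θ_{i-1}² + 1/(θ₀ θ_{k-1}) - (1 - θ₀)/θ₀²`, for `k ≥ 1`. -/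
def totalWeight (θ₀ : ℝ) (k : ℕ) : ℝ :=
  ∑ i ∈ Finset.range k, gammaCoeff θ₀ k i * invThetaPrevSq θ₀ i + lastWeight θ₀ k

/-- `m_k(μ)`, for `k ≥ 1`. -/
def mCoeff (θ₀ : ℝ) (k : ℕ) (μ : ℝ) : ℝ :=
  μ * θ₀ ^ 2 / (1 + μ * (1 - θ₀)) * totalWeight θ₀ k

/-- The convex combination of the iterates `X 0, …, X k`, for `k ≥ 1`. -/
def centerPoint {n : ℕ} (θ₀ : ℝ) (X : ℕ → EuclideanSpace ℝ (Fin n)) (k : ℕ) :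
    EuclideanSpace ℝ (Fin n) :=
  (1 / totalWeight θ₀ k) •
    (∑ i ∈ Finset.range k, (gammaCoeff θ₀ k i * invThetaPrevSq θ₀ i) • X i
      + lastWeight θ₀ k • X k)

/-- The restart point `σ X_k + (1 - σ) centerPoint_k`. -/
def restartPoint {n : ℕ} (θ₀ σ : ℝ) (X : ℕ → EuclideanSpace ℝ (Fin n)) (k : ℕ) :
    EuclideanSpace ℝ (Fin n) :=
  σ • X k + (1 - σ) • centerPoint θ₀ X k

/-! ### APPROX with restarts -/

/-- A minimizer of `φ` over `ℝ` (an arbitrary real number if there is none). -/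
def argminReal (φ : ℝ → WithTop ℝ) : ℝ :=
  Classical.epsilon fun t => ∀ s, φ t ≤ φ s

/-- The state of the algorithm: `age` is the number of iterations since the last restart,
`hist i` (for `i ≤ age`) is the `i`-th iterate `x` since the last restart, and `z` is the
current auxiliary point. -/
structure ApproxState (n : ℕ) where
  age : ℕ
  hist : ℕ → EuclideanSpace ℝ (Fin n)
  z : EuclideanSpace ℝ (Fin n)

/-- The current iterate. -/
def ApproxState.x {n : ℕ} (s : ApproxState n) : EuclideanSpace ℝ (Fin n) :=
  s.hist s.age

/-- The state in which the algorithm starts, or restarts, at the point `x`. -/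
def ApproxState.start {n : ℕ} (x : EuclideanSpace ℝ (Fin n)) : ApproxState n where
  age := 0
  hist := fun _ => x
  z := x

/-- One iteration of APPROX with the set `T` of coordinates, where `θ₀ = τ/n`. -/
def approxStep {n : ℕ} (f : EuclideanSpace ℝ (Fin n) → ℝ) (ψ : Fin n → ℝ → WithTop ℝ)
    (v : Fin n → ℝ) (τ : ℝ) (T : Finset (Fin n)) (s : ApproxState n) : ApproxState n :=
  let θ := thetaSeq (τ / n) s.age
  let y := (1 - θ) • s.x + θ • s.z
  let z' : EuclideanSpace ℝ (Fin n) := WithLp.toLp 2 fun i =>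
    if i ∈ T then
      argminReal fun t =>
        ((gradient f y i * (t - y i) + θ * n * v i / (2 * τ) * (t - s.z i) ^ 2 : ℝ) :
          WithTop ℝ) + ψ i t
    else s.z i
  { age := s.age + 1
    hist := Function.update s.hist (s.age + 1) (y + ((n : ℝ) / τ * θ) • (z' - s.z))
    z := z' }

/-- The state of restarted APPROX after `k` iterations, started at `x₀`, when the sets of
coordinates are `T 0, T 1, …`: iteration `k` is followed by a restart whenever
`k ≡ r (mod K)`. -/
def restartedState {n : ℕ} (f : EuclideanSpace ℝ (Fin n) → ℝ) (ψ : Fin n → ℝ → WithTop ℝ)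
    (v : Fin n → ℝ) (τ σ : ℝ) (K r : ℕ) (x₀ : EuclideanSpace ℝ (Fin n))
    (T : ℕ → Finset (Fin n)) : ℕ → ApproxState n
  | 0 => ApproxState.start x₀
  | k + 1 =>
    let s := approxStep f ψ v τ (T k) (restartedState f ψ v τ σ K r x₀ T k)
    if k ≡ r [MOD K] then ApproxState.start (restartPoint (τ / n) σ s.hist s.age) else s

/-- The iterate `x_k` of restarted APPROX. -/
def restartedIterate {n : ℕ} (f : EuclideanSpace ℝ (Fin n) → ℝ) (ψ : Fin n → ℝ → WithTop ℝ)
    (v : Fin n → ℝ) (τ σ : ℝ) (K r : ℕ) (x₀ : EuclideanSpace ℝ (Fin n))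
    (T : ℕ → Finset (Fin n)) (k : ℕ) : EuclideanSpace ℝ (Fin n) :=
  (restartedState f ψ v τ σ K r x₀ T k).x

/-! ### The iteration bound -/

/-- `(n/τ) (6√6 max(1/√μ, √μ/μF) log(D₀/ε) + 2√3 √(1 + 1/μ))`. -/
def iterationBound (n : ℕ) (τ μ μF D₀ ε : ℝ) : ℝ :=
  n / τ * (6 * √6 * max (1 / √μ) (√μ / μF) * Real.log (D₀ / ε) + 2 * √3 * √(1 + 1 / μ))

end

/-! Within one run, let `F̂_k` be `f(x_k)` plus the `γ_k`-average of `ψ(z_0), …, ψ(z_k)`. Since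
`x_k` is the same average of the `z_i`, Jensen gives `F(x_k) ≤ F̂_k`. The Lyapunov function `L_k =
(θ₀²/θ_{k-1}²)(F̂_k - F(x⋆)) + ½‖z_k - x⋆‖_v²` starts at `D(x_0)` and does not increase in
conditional expectation (`approx_one_step`, `sum_lyapunov_update_le`); this combines ESO, convexity
of `f` and strong convexity of the coordinate subproblems.

Bounding `½‖x_k - x⋆‖_v²` by the `γ_k`-average of `½‖z_i - x⋆‖_v²` and rewriting each term through
`L_i` gives `E D(x_k) + θ₀² W_k E[F(x̊) - F(x⋆)] ≤ D(x_0)` (`potential_add_gap_le`,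
`integral_potential_add_gap_le`). So `E D` never increases, neither at the iterates nor at their
convex combinations. Moreover the growth condition gives `D(x̊) ≤ (1/μ_F + 1 - θ₀)(F(x̊) - F(x⋆))`,
so the second term controls `D(x̊)`. With `σ = 1/(1 + m_K(μ))`, convexity of `D` makes a restart
contract `E D` by `1 - min(m_K(μ), m_K(μ_F))/(1 + m_K(μ))`
(`integral_potential_restartPoint_le_factor`), even when `μ` misjudges `μ_F`.

The period `K` is long enough for `m_K(μ) ≥ 1` (`one_le_mCoeff`), so the factor is at most `1 -
min(1, μ_F/μ)/3` (`restartFactor_le`). After `k` iterations at least `k/K - 1` full runs are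
complete; incomplete runs do no harm. The bound on `k` then follows from `1 - s ≤ exp(-s)` and an
upper bound on `K` (`restartFactor_pow_mul_le`). -/

/-! ### The coefficients θ and γ, and the weights of the center point -/

theorem thetaSeq_pos {θ₀ : ℝ} (h0 : 0 < θ₀) (k : ℕ) : 0 < thetaSeq θ₀ k := by
  induction k with
  | zero => exact h0
  | succ k ih =>
    have h : thetaSeq θ₀ k ^ 2 < Real.sqrt (thetaSeq θ₀ k ^ 4 + 4 * thetaSeq θ₀ k ^ 2) := by
      apply Real.lt_sqrt_of_sq_lt
      have : 0 < thetaSeq θ₀ k ^ 2 := by positivity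
      nlinarith
    rw [thetaSeq]
    linarith

/-- The recursion picks a root of `t² + θ_k² t - θ_k² = 0`. This is the only form in which the
square root is used afterwards. -/
theorem thetaSeq_succ_sq {θ₀ : ℝ} (k : ℕ) :
    thetaSeq θ₀ (k + 1) ^ 2 = (1 - thetaSeq θ₀ (k + 1)) * thetaSeq θ₀ k ^ 2 := by
  have h := Real.sq_sqrt (show 0 ≤ thetaSeq θ₀ k ^ 4 + 4 * thetaSeq θ₀ k ^ 2 by positivity)
  rw [thetaSeq]
  linear_combination (1 / 4) * h

theorem thetaSeq_succ_le {θ₀ : ℝ} (h0 : 0 < θ₀) (k : ℕ) :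
    thetaSeq θ₀ (k + 1) ≤ thetaSeq θ₀ k := by
  have h := thetaSeq_succ_sq (θ₀ := θ₀) k
  have h1 := thetaSeq_pos h0 k
  have h2 := thetaSeq_pos h0 (k + 1)
  have h3 : 0 < thetaSeq θ₀ k ^ 2 := by positivity
  exact (abs_le_of_sq_le_sq' (by nlinarith) h1.le).2

theorem thetaSeq_le {θ₀ : ℝ} (h0 : 0 < θ₀) (k : ℕ) : thetaSeq θ₀ k ≤ θ₀ := by
  induction k with
  | zero => exact le_rfl
  | succ k ih => exact (thetaSeq_succ_le h0 k).trans ih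

/-- With `u = 1/θ_{k+1}` and `w = 1/θ_k` the recursion reads `u² - u = w²`, so `(u - 1/2)² ≥ w²`. -/
theorem inv_thetaSeq_succ_ge {θ₀ : ℝ} (h0 : 0 < θ₀) (k : ℕ) :
    1 / thetaSeq θ₀ k + 1 / 2 ≤ 1 / thetaSeq θ₀ (k + 1) := by
  have h := thetaSeq_succ_sq (θ₀ := θ₀) k
  have h1 := thetaSeq_pos h0 k
  have h2 := thetaSeq_pos h0 (k + 1)
  set a := thetaSeq θ₀ k
  set b := thetaSeq θ₀ (k + 1)
  have hb : b ≤ 1 := by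
    by_contra hb
    have : 0 < a ^ 2 := by positivity
    nlinarith [sq_nonneg b]
  have hu : (1 / b) ^ 2 - 1 / b = (1 / a) ^ 2 := by
    field_simp
    linear_combination -h
  have h1b : 1 ≤ 1 / b := by rw [le_div_iff₀ h2]; linarith
  have : 1 / a ≤ 1 / b - 1 / 2 :=
    (abs_le_of_sq_le_sq' (by nlinarith) (by linarith)).2
  linarith

theorem inv_thetaSeq_ge {θ₀ : ℝ} (h0 : 0 < θ₀) (k : ℕ) :
    1 / θ₀ + k / 2 ≤ 1 / thetaSeq θ₀ k := by
  induction k with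
  | zero => simp [thetaSeq]
  | succ k ih =>
    have := inv_thetaSeq_succ_ge h0 k
    push_cast
    linarith

/-- The convention at index `0` is chosen so that this formula has no exception; it links the
weights of consecutive Lyapunov functions. -/
theorem invThetaPrevSq_eq {θ₀ : ℝ} (h0 : 0 < θ₀) (k : ℕ) :
    invThetaPrevSq θ₀ k = (1 - thetaSeq θ₀ k) / thetaSeq θ₀ k ^ 2 := by
  cases k with
  | zero => rfl
  | succ k =>
    have h := thetaSeq_succ_sq (θ₀ := θ₀) k
    have h1 := thetaSeq_pos h0 k
    have h2 := thetaSeq_pos h0 (k + 1)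
    rw [invThetaPrevSq]
    field_simp
    linear_combination h

theorem invThetaPrevSq_succ {θ₀ : ℝ} (h0 : 0 < θ₀) (k : ℕ) :
    invThetaPrevSq θ₀ (k + 1) = invThetaPrevSq θ₀ k + 1 / thetaSeq θ₀ k := by
  have h1 := thetaSeq_pos h0 k
  rw [invThetaPrevSq_eq h0 k, invThetaPrevSq]
  field_simp
  ring

theorem invThetaPrevSq_nonneg {θ₀ : ℝ} (h0 : 0 < θ₀) (h1 : θ₀ ≤ 1) (k : ℕ) :
    0 ≤ invThetaPrevSq θ₀ k := by
  rw [invThetaPrevSq_eq h0]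
  have := thetaSeq_le h0 k
  exact div_nonneg (by linarith) (by positivity)

theorem gammaCoeff_self {θ₀ : ℝ} (h0 : 0 < θ₀) (k : ℕ) :
    gammaCoeff θ₀ (k + 1) (k + 1) = 1 / θ₀ * thetaSeq θ₀ k := by
  cases k with
  | zero => simp [gammaCoeff, thetaSeq, h0.ne']
  | succ k => simp [gammaCoeff]

/-- The combinations `∑ i ≤ k, γ_k^i Z_i` obey the recursion that defines the iterates. -/
theorem sum_gammaCoeff_succ {E : Type*} [AddCommGroup E] [Module ℝ E] {θ₀ : ℝ} (h0 : 0 < θ₀)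
    (Z : ℕ → E) (k : ℕ) :
    ∑ i ∈ Finset.range (k + 2), gammaCoeff θ₀ (k + 1) i • Z i =
      (1 - thetaSeq θ₀ k) • ∑ i ∈ Finset.range (k + 1), gammaCoeff θ₀ k i • Z i
        + thetaSeq θ₀ k • Z k + (1 / θ₀ * thetaSeq θ₀ k) • (Z (k + 1) - Z k) := by
  cases k with
  | zero =>
    simp [gammaCoeff, thetaSeq, h0.ne', sub_smul]
  | succ k =>
    rw [Finset.sum_range_succ, Finset.sum_range_succ, Finset.sum_range_succ _ (k + 1),
      gammaCoeff_self h0 (k + 1), gammaCoeff_self h0 k, smul_add, Finset.smul_sum]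
    have hmid : gammaCoeff θ₀ (k + 1 + 1) (k + 1) =
        thetaSeq θ₀ (k + 1) * (1 - 1 / θ₀ * thetaSeq θ₀ k)
          + 1 / θ₀ * (thetaSeq θ₀ k - thetaSeq θ₀ (k + 1)) := by simp [gammaCoeff]
    have hlow : ∑ i ∈ Finset.range (k + 1), gammaCoeff θ₀ (k + 1 + 1) i • Z i =
        ∑ i ∈ Finset.range (k + 1),
          (1 - thetaSeq θ₀ (k + 1)) • gammaCoeff θ₀ (k + 1) i • Z i := by
      refine Finset.sum_congr rfl fun i hi => ?_
      have : i ≤ k := by simpa [Nat.lt_succ_iff] using hi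
      rw [smul_smul]
      simp [gammaCoeff, this]
    rw [hmid, hlow]
    module

/-- The only delicate coefficient is the middle one: its two summands are nonnegative because `θ_k ≤
θ₀` and because `θ` is nonincreasing. -/
theorem gammaCoeff_nonneg {θ₀ : ℝ} (h0 : 0 < θ₀) (h1 : θ₀ ≤ 1) (k i : ℕ) :
    0 ≤ gammaCoeff θ₀ k i := by
  induction k using Nat.strong_induction_on generalizing i with
  | _ k ih =>
    match k with
    | 0 => simp only [gammaCoeff]; split_ifs <;> norm_num
    | 1 => simp only [gammaCoeff]; split_ifs <;> norm_num
    | k + 2 =>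
      have hp := thetaSeq_pos h0 (k + 1)
      have hle := thetaSeq_succ_le h0 k
      have hk := thetaSeq_le h0 k
      simp only [gammaCoeff]
      split_ifs
      · exact mul_nonneg (by linarith) (ih (k + 1) (by omega) i)
      · have h2 : 1 / θ₀ * thetaSeq θ₀ k ≤ 1 := by
          rw [one_div_mul_eq_div, div_le_one h0]; exact hk
        have h3 : 0 ≤ 1 / θ₀ := by positivity
        exact add_nonneg (mul_nonneg hp.le (by linarith)) (mul_nonneg h3 (by linarith))
      · positivity
      · exact le_rfl

theorem sum_gammaCoeff {θ₀ : ℝ} (h0 : 0 < θ₀) (k : ℕ) :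
    ∑ i ∈ Finset.range (k + 1), gammaCoeff θ₀ k i = 1 := by
  induction k with
  | zero => simp [gammaCoeff]
  | succ k ih =>
    have := sum_gammaCoeff_succ h0 (fun _ => (1 : ℝ)) k
    simp only [smul_eq_mul, mul_one, ih] at this
    rw [this]
    ring

theorem lastWeight_pos {θ₀ : ℝ} (h0 : 0 < θ₀) (k : ℕ) :
    0 < lastWeight θ₀ k := by
  have hp := thetaSeq_pos h0 (k - 1)
  have hle := thetaSeq_le h0 (k - 1)
  have h : 1 / θ₀ ^ 2 ≤ 1 / (θ₀ * thetaSeq θ₀ (k - 1)) := by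
    apply one_div_le_one_div_of_le (by positivity)
    rw [sq]
    exact mul_le_mul_of_nonneg_left hle h0.le
  have h2 : (1 - θ₀) / θ₀ ^ 2 < 1 / θ₀ ^ 2 := by
    gcongr
    linarith
  rw [lastWeight]
  linarith

theorem totalWeight_pos {θ₀ : ℝ} (h0 : 0 < θ₀) (h1 : θ₀ ≤ 1) (k : ℕ) :
    0 < totalWeight θ₀ k :=
  add_pos_of_nonneg_of_pos (Finset.sum_nonneg fun i _ =>
    mul_nonneg (gammaCoeff_nonneg h0 h1 k i) (invThetaPrevSq_nonneg h0 h1 i)) (lastWeight_pos h0 k)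

/-- The surplus `(1 - θ₀)/θ₀²` over the weight kept in the center point is what later supplies the
term `(1 - θ₀)(F(x_k) - F(x⋆))` of the potential. -/
theorem gammaCoeff_self_mul {θ₀ : ℝ} (h0 : 0 < θ₀) {k : ℕ} (hk : 1 ≤ k) :
    gammaCoeff θ₀ k k * invThetaPrevSq θ₀ k = lastWeight θ₀ k + (1 - θ₀) / θ₀ ^ 2 := by
  obtain ⟨k, rfl⟩ := Nat.exists_eq_add_of_le' hk
  have hp := thetaSeq_pos h0 k
  rw [gammaCoeff_self h0, invThetaPrevSq, lastWeight, Nat.add_sub_cancel]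
  field_simp
  ring

theorem totalWeight_eq {θ₀ : ℝ} (h0 : 0 < θ₀) {k : ℕ} (hk : 1 ≤ k) :
    totalWeight θ₀ k =
      ∑ i ∈ Finset.range (k + 1), gammaCoeff θ₀ k i * invThetaPrevSq θ₀ i
        - (1 - θ₀) / θ₀ ^ 2 := by
  rw [Finset.sum_range_succ, gammaCoeff_self_mul h0 hk, totalWeight]
  ring

/-- Write `a = 1/θ_{k-1}²`, `t = θ_k` and `A` for the sum. The recursion for `γ` turns `A` into `(1
- t) A + t a + 1/θ₀`, with `t a = 1/t - 1`, while `a` grows to `a + 1/t`. Half of the growth is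
matched because `1/θ₀ ≥ 1`. -/
theorem half_invThetaPrevSq_le_sum {θ₀ : ℝ} (h0 : 0 < θ₀) (h1 : θ₀ ≤ 1) (k : ℕ) :
    invThetaPrevSq θ₀ k / 2 ≤
      ∑ i ∈ Finset.range (k + 1), gammaCoeff θ₀ k i * invThetaPrevSq θ₀ i := by
  induction k with
  | zero =>
    have := invThetaPrevSq_nonneg h0 h1 0
    simp [gammaCoeff]
    linarith
  | succ k ih =>
    have h := sum_gammaCoeff_succ h0 (invThetaPrevSq θ₀) k
    simp only [smul_eq_mul] at h
    have hp := thetaSeq_pos h0 k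
    have hle := thetaSeq_le h0 k
    have hs := invThetaPrevSq_succ h0 k
    have ha := invThetaPrevSq_eq h0 k
    rw [h, hs]
    set A := ∑ i ∈ Finset.range (k + 1), gammaCoeff θ₀ k i * invThetaPrevSq θ₀ i
    set a := invThetaPrevSq θ₀ k
    set t := thetaSeq θ₀ k
    have e1 : t * a = 1 / t - 1 := by rw [ha]; field_simp
    have e2 : 1 / θ₀ * t * (a + 1 / t - a) = 1 / θ₀ := by field_simp; ring
    have e3 : 1 ≤ 1 / θ₀ := by rw [le_div_iff₀ h0]; linarith
    rw [e1, e2]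
    have e4 : (1 - t) * (a / 2) ≤ (1 - t) * A := mul_le_mul_of_nonneg_left ih (by linarith)
    have e5 : (1 - t) * (a / 2) = a / 2 - (1 / t - 1) / 2 := by rw [← e1]; ring
    linarith

/-- The choice of `K` makes `1/θ₀ + (K - 1)/2`, a lower bound for `1/θ_{K-1}`, at least `s/θ₀` with
`s² = 3(1 + 1/μ)`. Hence `θ₀² W_K ≥ s²/2 - 1`, which exceeds `1/μ + 1 - θ₀` because `μ ≤ 1`. -/
theorem one_le_mCoeff {θ₀ μ : ℝ} (h0 : 0 < θ₀) (h1 : θ₀ ≤ 1) (hμ : 0 < μ) (hμ1 : μ ≤ 1) {K : ℕ}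
    (hK : 2 * √3 / θ₀ * √(1 + 1 / μ) - 2 / θ₀ + 1 ≤ K) : 1 ≤ mCoeff θ₀ K μ := by
  have hK1 : 1 ≤ K := by
    rcases Nat.eq_zero_or_pos K with h | h
    · exfalso
      rw [h] at hK
      have a1 : 1 ≤ √3 := Real.one_le_sqrt.2 (by norm_num)
      have a2 : 1 ≤ √(1 + 1 / μ) := Real.one_le_sqrt.2 (by simp [hμ.le])
      have a3 : 1 ≤ √3 * √(1 + 1 / μ) := one_le_mul_of_one_le_of_one_le a1 a2
      have : 2 * √3 / θ₀ * √(1 + 1 / μ) - 2 / θ₀ = 2 / θ₀ * (√3 * √(1 + 1 / μ) - 1) := by ring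
      have : 0 ≤ 2 / θ₀ * (√3 * √(1 + 1 / μ) - 1) := mul_nonneg (by positivity) (by linarith)
      push_cast at hK
      linarith
    · exact h
  obtain ⟨k, rfl⟩ := Nat.exists_eq_add_of_le' hK1
  have hu := inv_thetaSeq_ge h0 k
  have hA := half_invThetaPrevSq_le_sum h0 h1 (k + 1)
  have hW := totalWeight_eq h0 hK1
  have hp := thetaSeq_pos h0 k
  set s := √3 * √(1 + 1 / μ) with hs
  have hs2 : s ^ 2 = 3 * (1 + 1 / μ) := by
    rw [hs, mul_pow, Real.sq_sqrt (by norm_num), Real.sq_sqrt (by positivity)]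
  have hsu : s / θ₀ ≤ 1 / thetaSeq θ₀ k := by
    refine le_trans ?_ hu
    push_cast at hK
    have : 2 * √3 / θ₀ * √(1 + 1 / μ) = 2 * (s / θ₀) := by rw [hs]; ring
    have : 2 / θ₀ = 2 * (1 / θ₀) := by ring
    linarith
  have hsq : s ^ 2 ≤ θ₀ ^ 2 * invThetaPrevSq θ₀ (k + 1) := by
    have : (s / θ₀) ^ 2 ≤ (1 / thetaSeq θ₀ k) ^ 2 := pow_le_pow_left₀ (by positivity) hsu 2
    rw [invThetaPrevSq]
    rw [div_pow, div_pow, one_pow, div_le_iff₀ (by positivity)] at this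
    linarith
  have hW2 : s ^ 2 / 2 - 1 ≤ θ₀ ^ 2 * totalWeight θ₀ (k + 1) := by
    rw [hW, mul_sub, mul_div_cancel₀ _ (by positivity)]
    have := mul_le_mul_of_nonneg_left hA (show 0 ≤ θ₀ ^ 2 by positivity)
    linarith
  have hμi : 1 ≤ 1 / μ := by rw [le_div_iff₀ hμ]; linarith
  rw [mCoeff, div_mul_eq_mul_div, le_div_iff₀ (by nlinarith), one_mul]
  have : 1 / μ + (1 - θ₀) ≤ θ₀ ^ 2 * totalWeight θ₀ (k + 1) := by linarith
  calc 1 + μ * (1 - θ₀) = μ * (1 / μ + (1 - θ₀)) := by field_simp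
    _ ≤ μ * (θ₀ ^ 2 * totalWeight θ₀ (k + 1)) := mul_le_mul_of_nonneg_left this hμ.le
    _ = _ := by ring

/-! ### Closed convex functions on the line and the coordinate subproblem -/

theorem IsClosedConvex.combo_le {g : ℝ → WithTop ℝ} (hg : IsClosedConvex g) {s t a b : ℝ}
    (hs : g s ≠ ⊤) (ht : g t ≠ ⊤) (ha : 0 ≤ a) (hb : 0 ≤ b) (hab : a + b = 1) :
    g (a * s + b * t) ≤ ((a * (g s).untopD 0 + b * (g t).untopD 0 : ℝ) : WithTop ℝ) := by
  lift g s to ℝ using hs with u hu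
  lift g t to ℝ using ht with w hw
  have h := hg.2 (x := (s, u)) (by simp [hu]) (y := (t, w)) (by simp [hw]) ha hb hab
  simpa using h

theorem IsClosedConvex.combo_ne_top {g : ℝ → WithTop ℝ} (hg : IsClosedConvex g) {s t a b : ℝ}
    (hs : g s ≠ ⊤) (ht : g t ≠ ⊤) (ha : 0 ≤ a) (hb : 0 ≤ b) (hab : a + b = 1) :
    g (a * s + b * t) ≠ ⊤ :=
  ne_top_of_le_ne_top (WithTop.coe_ne_top) (hg.combo_le hs ht ha hb hab)

/-- The effective domain of a closed convex function is convex, and the function is convex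
on it. -/
theorem IsClosedConvex.convexOn {g : ℝ → WithTop ℝ} (hg : IsClosedConvex g) :
    ConvexOn ℝ {t | g t ≠ ⊤} fun t => (g t).untopD 0 := by
  refine ⟨fun s hs t ht a b ha hb hab => hg.combo_ne_top hs ht ha hb hab, ?_⟩
  intro s hs t ht a b ha hb hab
  have h := hg.combo_le hs ht ha hb hab
  have h' := hg.combo_ne_top hs ht ha hb hab
  simp only [smul_eq_mul]
  lift g (a * s + b * t) to ℝ using h' with u
  simpa using WithTop.coe_le_coe.1 h

/-- A point just below the graph is strictly separated from the epigraph. The separating functional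
has positive vertical component, since the graph point directly above it lies in the epigraph. -/
theorem IsClosedConvex.exists_affine_le {g : ℝ → WithTop ℝ} (hg : IsClosedConvex g) {t₀ : ℝ}
    (h₀ : g t₀ ≠ ⊤) : ∃ α β : ℝ, ∀ t s : ℝ, g t ≤ s → α * t + β ≤ s := by
  lift g t₀ to ℝ using h₀ with u hu
  have hmem : ((t₀, u - 1) : ℝ × ℝ) ∉ {p : ℝ × ℝ | g p.1 ≤ (p.2 : WithTop ℝ)} := by
    simp only [Set.mem_ofPred_eq, ← hu, WithTop.coe_le_coe]
    linarith
  obtain ⟨L, w, hL, hLE⟩ := geometric_hahn_banach_point_closed hg.2 hg.1 hmem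
  have hexp : ∀ t s : ℝ, L (t, s) = L (1, 0) * t + L (0, 1) * s := by
    intro t s
    have : ((t, s) : ℝ × ℝ) = t • (1, 0) + s • (0, 1) := by simp
    rw [this, map_add, map_smul, map_smul]
    simp [mul_comm]
  have h1 := hLE (t₀, u) (by simp [hu])
  rw [hexp] at hL h1
  have hpos : 0 < L (0, 1) := by nlinarith
  refine ⟨-L (1, 0) / L (0, 1), w / L (0, 1), fun t s hts => ?_⟩
  have h2 := hLE (t, s) hts
  rw [hexp] at h2
  rw [div_mul_eq_mul_div, ← add_div, div_le_iff₀ hpos]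
  linarith

theorem abs_le_of_quadratic_le {c B D t : ℝ} (hc : 0 < c) (hB : 0 ≤ B) (hD : 0 ≤ D)
    (h : c * t ^ 2 ≤ B * |t| + D) : |t| ≤ 1 + (B + D) / c := by
  by_contra hlt
  push Not at hlt
  have h0 : 0 ≤ (B + D) / c := by positivity
  have h1 : 1 < |t| := by linarith
  have h2 : B + D < c * |t| := by
    have : (B + D) / c < |t| := by linarith
    rw [div_lt_iff₀ hc] at this
    linarith
  rw [← sq_abs] at h
  nlinarith

/-- A quadratic with positive leading coefficient plus a proper closed convex function attains its
minimum. -/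
theorem IsClosedConvex.exists_forall_quadratic_add_le {g : ℝ → WithTop ℝ} (hg : IsClosedConvex g)
    {t₀ : ℝ} (h₀ : g t₀ ≠ ⊤) {b c : ℝ} (hc : 0 < c) (y z : ℝ) :
    ∃ t, ∀ s, ((b * (t - y) + c * (t - z) ^ 2 : ℝ) : WithTop ℝ) + g t ≤
      ((b * (s - y) + c * (s - z) ^ 2 : ℝ) : WithTop ℝ) + g s := by
  obtain ⟨α, β, hαβ⟩ := hg.exists_affine_le h₀
  lift g t₀ to ℝ using h₀ with u hu
  let q : ℝ × ℝ → ℝ := fun p => b * (p.1 - y) + c * (p.1 - z) ^ 2 + p.2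
  have hq : Continuous q := by fun_prop
  set M := q (t₀, u) with hM
  -- Minimizing the continuous `q` over the closed epigraph avoids any semicontinuity argument for
  -- `g`. The affine minorant and the quadratic term make this sublevel set bounded.
  let C : Set (ℝ × ℝ) := {p | g p.1 ≤ (p.2 : WithTop ℝ)} ∩ {p | q p ≤ M}
  have hCcl : IsClosed C := hg.1.inter (isClosed_le hq continuous_const)
  have hmem : (t₀, u) ∈ C := ⟨by simp [hu], by simp [hM]⟩
  set B := |α + b - 2 * c * z| with hB
  set D := |M - β + b * y - c * z ^ 2| with hD
  set R := 1 + (B + D) / c with hR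
  have hbound : ∀ p ∈ C, |p.1| ≤ R := by
    rintro ⟨t, s⟩ ⟨h1, h2⟩
    have h3 := hαβ t s h1
    simp only [Set.mem_ofPred_eq, q] at h2
    apply abs_le_of_quadratic_le hc (abs_nonneg _) (abs_nonneg _)
    have e1 : -((α + b - 2 * c * z) * t) ≤ B * |t| := by
      rw [hB, ← abs_mul]; exact neg_le_abs _
    have e2 := le_abs_self (M - β + b * y - c * z ^ 2)
    rw [← hD] at e2
    simp only
    nlinarith
  have hsub : C ⊆ Set.Icc (-R) R ×ˢ Set.Icc (-(|α| * R) + β) (M + |b| * (R + |y|)) := by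
    rintro ⟨t, s⟩ hp
    have ht := hbound _ hp
    obtain ⟨h1, h2⟩ := hp
    have h3 := hαβ t s h1
    simp only [Set.mem_ofPred_eq, q] at h2
    simp only at ht
    refine ⟨abs_le.1 ht, ?_, ?_⟩
    · have : -(α * t) ≤ |α| * R := (neg_le_abs _).trans (by rw [abs_mul]; gcongr)
      simp only
      linarith
    · have : -(b * (t - y)) ≤ |b| * (R + |y|) := by
        refine (neg_le_abs _).trans ?_
        rw [abs_mul]
        gcongr
        exact (abs_sub _ _).trans (by gcongr)
      have : 0 ≤ c * (t - z) ^ 2 := by positivity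
      simp only
      linarith
  have hcomp : IsCompact C := (isCompact_Icc.prod isCompact_Icc).of_isClosed_subset hCcl hsub
  obtain ⟨⟨t, s⟩, htC, hmin⟩ := hcomp.exists_isMinOn ⟨_, hmem⟩ hq.continuousOn
  refine ⟨t, fun t' => ?_⟩
  by_cases h' : g t' = ⊤
  · simp [h']
  lift g t' to ℝ using h' with u' hu'
  have key : q (t, s) ≤ q (t', u') := by
    by_cases hle : q (t', u') ≤ M
    · exact hmin ⟨by simp [hu'], hle⟩
    · exact htC.2.trans (not_le.1 hle).le
  calc ((b * (t - y) + c * (t - z) ^ 2 : ℝ) : WithTop ℝ) + g t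
      ≤ ((b * (t - y) + c * (t - z) ^ 2 : ℝ) : WithTop ℝ) + (s : WithTop ℝ) := by
        gcongr; exact htC.1
    _ ≤ _ := by
        rw [← WithTop.coe_add, ← WithTop.coe_add, WithTop.coe_le_coe]
        exact key

/-- The extra term `c (s - p)²` comes from strong convexity of the subproblem; it is what makes the
distances `‖z_k - x⋆‖_v²` telescope. -/
theorem IsClosedConvex.argminReal_spec {g : ℝ → WithTop ℝ} (hg : IsClosedConvex g)
    {t₀ : ℝ} (h₀ : g t₀ ≠ ⊤) {b c : ℝ} (hc : 0 < c) (y z p : ℝ)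
    (hp : p = argminReal fun t => ((b * (t - y) + c * (t - z) ^ 2 : ℝ) : WithTop ℝ) + g t) :
    g p ≠ ⊤ ∧ ∀ s, g s ≠ ⊤ →
      b * (p - y) + c * (p - z) ^ 2 + (g p).untopD 0 + c * (s - p) ^ 2 ≤
        b * (s - y) + c * (s - z) ^ 2 + (g s).untopD 0 := by
  have hmin : ∀ s, ((b * (p - y) + c * (p - z) ^ 2 : ℝ) : WithTop ℝ) + g p ≤
      ((b * (s - y) + c * (s - z) ^ 2 : ℝ) : WithTop ℝ) + g s := by
    rw [hp]
    exact Classical.epsilon_spec (hg.exists_forall_quadratic_add_le h₀ hc y z)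
  have hfin : g p ≠ ⊤ := by
    intro h
    have := hmin t₀
    rw [h, WithTop.add_top, top_le_iff, WithTop.add_eq_top] at this
    exact this.elim WithTop.coe_ne_top h₀
  have hreal : ∀ s, g s ≠ ⊤ → b * (p - y) + c * (p - z) ^ 2 + (g p).untopD 0 ≤
      b * (s - y) + c * (s - z) ^ 2 + (g s).untopD 0 := by
    intro s hs
    have h := hmin s
    lift g s to ℝ using hs with w
    lift g p to ℝ using hfin with w'
    rw [← WithTop.coe_add, ← WithTop.coe_add, WithTop.coe_le_coe] at h
    simpa using h
  refine ⟨hfin, fun s hs => ?_⟩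
  -- Minimality is tested at `(1 - l) p + l s` and the inequality divided by `l`; then `l` is made
  -- small.
  have hcomb : ∀ l : ℝ, 0 < l → l ≤ 1 →
      b * (p - y) + c * (p - z) ^ 2 + (g p).untopD 0 + (1 - l) * (c * (s - p) ^ 2) ≤
        b * (s - y) + c * (s - z) ^ 2 + (g s).untopD 0 := by
    intro l hl hl1
    have hdom := hg.convexOn.1 hfin hs (sub_nonneg.2 hl1) hl.le (by ring)
    have hcv := hg.convexOn.2 hfin hs (sub_nonneg.2 hl1) hl.le (by ring)
    have h := hreal _ hdom
    simp only [smul_eq_mul] at h hcv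
    refine le_of_mul_le_mul_left ?_ hl
    nlinarith
  refine le_of_forall_pos_lt_add fun e he => ?_
  have hX : 0 ≤ c * (s - p) ^ 2 := by positivity
  set X := c * (s - p) ^ 2
  have hl : 0 < e / (X + e + 1) := by positivity
  have hl1 : e / (X + e + 1) ≤ 1 := by rw [div_le_one (by positivity)]; linarith
  have h := hcomb _ hl hl1
  have : e / (X + e + 1) * X < e := by
    rw [div_mul_eq_mul_div, div_lt_iff₀ (by positivity)]
    nlinarith
  linarith

/-! ### Samplings -/

theorem PMF.sum_toReal {α : Type*} [Fintype α] (q : PMF α) : ∑ a, (q a).toReal = 1 := by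
  rw [← ENNReal.toReal_sum fun a _ => q.apply_ne_top a,
    ← tsum_fintype (L := .unconditional α), q.tsum_coe, ENNReal.toReal_one]

/-- The `n` inclusion probabilities are equal and sum to `E|Ŝ|`. -/
theorem IsUniformSampling.sum_mem {n : ℕ} {q : PMF (Finset (Fin n))} (hq : IsUniformSampling q)
    (i : Fin n) : ∑ T, (q T).toReal * (if i ∈ T then 1 else 0) = expectedSize q / n := by
  have hn : (n : ℝ) ≠ 0 := by
    have := i.pos
    positivity
  have h1 : ∀ j : Fin n, ∑ T, (q T).toReal * (if j ∈ T then (1 : ℝ) else 0) =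
      ∑ T, (q T).toReal * (if i ∈ T then (1 : ℝ) else 0) := by
    intro j
    have h := congrArg ENNReal.toReal (hq j i)
    rw [ENNReal.toReal_sum fun a _ => q.apply_ne_top a,
      ENNReal.toReal_sum fun a _ => q.apply_ne_top a] at h
    simpa [Finset.sum_filter] using h
  have h2 : expectedSize q =
      ∑ j : Fin n, ∑ T, (q T).toReal * (if j ∈ T then (1 : ℝ) else 0) := by
    rw [Finset.sum_comm, expectedSize]
    refine Finset.sum_congr rfl fun T _ => ?_
    rw [← Finset.mul_sum]
    simp
  rw [h2, Finset.sum_congr rfl fun j _ => h1 j]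
  simp [hn]

theorem expectedSize_div_le_one {n : ℕ} {q : PMF (Finset (Fin n))} :
    expectedSize q / n ≤ 1 := by
  rcases Nat.eq_zero_or_pos n with rfl | hn
  · simp
  rw [div_le_one (by positivity), expectedSize]
  calc ∑ T, (q T).toReal * (T.card : ℝ) ≤ ∑ T, (q T).toReal * (n : ℝ) := by
        refine Finset.sum_le_sum fun T _ => ?_
        have : (T.card : ℝ) ≤ n := by exact_mod_cast (card_finset_fin_le T)
        gcongr
    _ = n := by rw [← Finset.sum_mul, q.sum_toReal, one_mul]

/-- The point with the coordinates in `T` taken from `w` and the other ones from `z`. -/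
def replaceOn {n : ℕ} (T : Finset (Fin n)) (z w : EuclideanSpace ℝ (Fin n)) :
    EuclideanSpace ℝ (Fin n) :=
  WithLp.toLp 2 fun i => if i ∈ T then w i else z i

/-- By linearity only the inclusion probability of each single coordinate matters, so no
independence between coordinates is needed. -/
theorem IsUniformSampling.sum_replaceOn {n : ℕ} {q : PMF (Finset (Fin n))}
    (hq : IsUniformSampling q) (φ : Fin n → ℝ → ℝ) (z w : EuclideanSpace ℝ (Fin n)) :
    ∑ T, (q T).toReal * ∑ i, φ i (replaceOn T z w i) =
      (1 - expectedSize q / n) * ∑ i, φ i (z i) + expectedSize q / n * ∑ i, φ i (w i) := by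
  have h : ∀ T : Finset (Fin n), ∀ i, (q T).toReal * φ i (replaceOn T z w i) =
      (q T).toReal * φ i (z i) +
        (q T).toReal * (if i ∈ T then 1 else 0) * (φ i (w i) - φ i (z i)) := by
    intro T i
    by_cases hi : i ∈ T <;> simp [replaceOn, hi]
    ring
  simp_rw [Finset.mul_sum, h]
  rw [Finset.sum_comm, ← Finset.sum_add_distrib]
  refine Finset.sum_congr rfl fun i _ => ?_
  rw [Finset.sum_add_distrib, ← Finset.sum_mul, ← Finset.sum_mul, hq.sum_mem, q.sum_toReal]
  ring

theorem ConvexOn.add_inner_gradient_le {E : Type*} [NormedAddCommGroup E] [InnerProductSpace ℝ E]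
    [CompleteSpace E] {f : E → ℝ} (hf : ConvexOn ℝ Set.univ f) {y : E}
    (hd : DifferentiableAt ℝ f y) (x : E) :
    f y + inner ℝ (gradient f y) (x - y) ≤ f x := by
  have hg : ConvexOn ℝ Set.univ fun t : ℝ => f (AffineMap.lineMap y x t) :=
    hf.comp_affineMap (AffineMap.lineMap y x)
  have hderiv : HasDerivAt (fun t : ℝ => f (AffineMap.lineMap y x t))
      (inner ℝ (gradient f y) (x - y)) 0 := by
    have h1 : HasDerivAt (fun t : ℝ => (AffineMap.lineMap y x t : E)) (x - y) 0 :=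
      AffineMap.hasDerivAt_lineMap
    have h2 : HasFDerivAt f (fderiv ℝ f y) (AffineMap.lineMap y x (0 : ℝ)) := by
      simpa using hd.hasFDerivAt
    have h3 := h2.comp_hasDerivAt (0 : ℝ) h1
    rwa [← inner_gradient_left] at h3
  have h := hg.le_slope_of_hasDerivAt (Set.mem_univ 0) (Set.mem_univ 1) one_pos hderiv
  simp only [slope_def_field, AffineMap.lineMap_apply_one, AffineMap.lineMap_apply_zero] at h
  linarith

/-! ### The composite problem in real terms -/

/-- All coordinates of `x` lie in the effective domains of the functions `ψ i`. -/
def InDomain {n : ℕ} (ψ : Fin n → ℝ → WithTop ℝ) (x : EuclideanSpace ℝ (Fin n)) : Prop :=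
  ∀ i, ψ i (x i) ≠ ⊤

/-- The real value of `separableSum ψ x`, meaningful on the effective domain. -/
def separableReal {n : ℕ} (ψ : Fin n → ℝ → WithTop ℝ) (x : EuclideanSpace ℝ (Fin n)) : ℝ :=
  ∑ i, (ψ i (x i)).untopD 0

theorem separableSum_ne_top_iff {n : ℕ} {ψ : Fin n → ℝ → WithTop ℝ}
    {x : EuclideanSpace ℝ (Fin n)} : separableSum ψ x ≠ ⊤ ↔ InDomain ψ x := by
  simp [separableSum, InDomain, WithTop.sum_eq_top]

theorem objective_ne_top_iff {n : ℕ} {f : EuclideanSpace ℝ (Fin n) → ℝ}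
    {ψ : Fin n → ℝ → WithTop ℝ} {x : EuclideanSpace ℝ (Fin n)} :
    objective f ψ x ≠ ⊤ ↔ InDomain ψ x := by
  rw [← separableSum_ne_top_iff, objective, ne_eq, WithTop.add_eq_top]
  simp

theorem InDomain.separableSum_eq {n : ℕ} {ψ : Fin n → ℝ → WithTop ℝ}
    {x : EuclideanSpace ℝ (Fin n)} (hx : InDomain ψ x) :
    separableSum ψ x = (separableReal ψ x : WithTop ℝ) := by
  rw [separableSum, separableReal, WithTop.coe_sum]
  refine Finset.sum_congr rfl fun i _ => ?_
  have := hx i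
  lift ψ i (x i) to ℝ using this with u
  simp

theorem InDomain.objective_eq {n : ℕ} {f : EuclideanSpace ℝ (Fin n) → ℝ}
    {ψ : Fin n → ℝ → WithTop ℝ} {x : EuclideanSpace ℝ (Fin n)} (hx : InDomain ψ x) :
    objective f ψ x = ((f x + separableReal ψ x : ℝ) : WithTop ℝ) := by
  rw [objective, hx.separableSum_eq, WithTop.coe_add]

theorem objectiveGap_eq {n : ℕ} {f : EuclideanSpace ℝ (Fin n) → ℝ}
    {ψ : Fin n → ℝ → WithTop ℝ} {x y : EuclideanSpace ℝ (Fin n)} (hx : InDomain ψ x)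
    (hy : InDomain ψ y) :
    objectiveGap f ψ x y = f x + separableReal ψ x - (f y + separableReal ψ y) := by
  rw [objectiveGap, hx.objective_eq, hy.objective_eq]
  simp

theorem convexOn_separableReal {n : ℕ} {ψ : Fin n → ℝ → WithTop ℝ}
    (hψ : ∀ i, IsClosedConvex (ψ i)) : ConvexOn ℝ {x | InDomain ψ x} (separableReal ψ) := by
  constructor
  · intro x hx y hy a b ha hb hab i
    simpa using (hψ i).convexOn.1 (hx i) (hy i) ha hb hab
  · intro x hx y hy a b ha hb hab
    simp only [separableReal, smul_eq_mul, Finset.mul_sum]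
    rw [← Finset.sum_add_distrib]
    refine Finset.sum_le_sum fun i _ => ?_
    simpa using (hψ i).convexOn.2 (hx i) (hy i) ha hb hab

theorem convexOn_objectiveGap {n : ℕ} {f : EuclideanSpace ℝ (Fin n) → ℝ}
    {ψ : Fin n → ℝ → WithTop ℝ} (hf : ConvexOn ℝ Set.univ f) (hψ : ∀ i, IsClosedConvex (ψ i))
    {xs : EuclideanSpace ℝ (Fin n)} (hxs : InDomain ψ xs) :
    ConvexOn ℝ {x | InDomain ψ x} fun x => objectiveGap f ψ x xs := by
  have h1 := convexOn_separableReal hψ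
  have h2 := ((hf.subset (Set.subset_univ _) h1.1).add h1).add_const
    (-(f xs + separableReal ψ xs))
  refine h2.congr fun x hx => ?_
  rw [objectiveGap_eq hx hxs]
  simp [sub_eq_add_neg]

theorem weightedSq_nonneg {n : ℕ} {v : Fin n → ℝ} (hv : ∀ i, 0 < v i)
    (x : EuclideanSpace ℝ (Fin n)) : 0 ≤ weightedSq v x :=
  Finset.sum_nonneg fun i _ => mul_nonneg (hv i).le (sq_nonneg _)

theorem convexOn_weightedSq_sub {n : ℕ} {v : Fin n → ℝ} (hv : ∀ i, 0 < v i)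
    (xs : EuclideanSpace ℝ (Fin n)) :
    ConvexOn ℝ Set.univ fun x : EuclideanSpace ℝ (Fin n) => weightedSq v (x - xs) := by
  refine ⟨convex_univ, fun x _ y _ a b ha hb hab => ?_⟩
  simp only [weightedSq, smul_eq_mul, Finset.mul_sum]
  rw [← Finset.sum_add_distrib]
  refine Finset.sum_le_sum fun i _ => ?_
  obtain rfl : b = 1 - a := by linarith
  -- The convexity defect of the square: `a x² + b y² - (a x + b y)² = a b (x - y)²` when `a + b =
  -- 1`.
  have h : 0 ≤ v i * (a * (1 - a) * (x i - y i) ^ 2) :=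
    mul_nonneg (hv i).le (mul_nonneg (mul_nonneg ha hb) (sq_nonneg _))
  simp only [PiLp.sub_apply, PiLp.add_apply, PiLp.smul_apply, smul_eq_mul]
  nlinarith

theorem convexOn_potential {n : ℕ} {f : EuclideanSpace ℝ (Fin n) → ℝ}
    {ψ : Fin n → ℝ → WithTop ℝ} {v : Fin n → ℝ} (hf : ConvexOn ℝ Set.univ f)
    (hψ : ∀ i, IsClosedConvex (ψ i)) (hv : ∀ i, 0 < v i) {xs : EuclideanSpace ℝ (Fin n)}
    (hxs : InDomain ψ xs) {θ₀ : ℝ} (hθ : θ₀ ≤ 1) :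
    ConvexOn ℝ {x | InDomain ψ x} (potential f ψ v θ₀ xs) := by
  have h1 := convexOn_objectiveGap hf hψ hxs
  exact (h1.smul (sub_nonneg.2 hθ)).add
    (((convexOn_weightedSq_sub hv xs).subset (Set.subset_univ _) h1.1).smul (by norm_num))

/-! ### One iteration in expectation -/

/-- The expected decrease in one iteration, where `w` is the point `z` with all coordinates
updated. -/
theorem approx_one_step {n : ℕ} {f : EuclideanSpace ℝ (Fin n) → ℝ}
    {ψ : Fin n → ℝ → WithTop ℝ} {v : Fin n → ℝ} {q : PMF (Finset (Fin n))}
    (hf : ConvexOn ℝ Set.univ f) (hd : Differentiable ℝ f) (hq : IsUniformSampling q)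
    (hE : ESO f q v) (hτ : 0 < expectedSize q) {θ₀ θ : ℝ} (hθ₀ : θ₀ = expectedSize q / n)
    (hθ : 0 < θ) (hθ1 : θ ≤ 1) {x y z w xs : EuclideanSpace ℝ (Fin n)}
    (hy : y = (1 - θ) • x + θ • z)
    (hw : ∀ i, gradient f y i * (w i - y i) + θ / (2 * θ₀) * v i * (w i - z i) ^ 2
        + (ψ i (w i)).untopD 0 + θ / (2 * θ₀) * v i * (xs i - w i) ^ 2 ≤
      gradient f y i * (xs i - y i) + θ / (2 * θ₀) * v i * (xs i - z i) ^ 2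
        + (ψ i (xs i)).untopD 0) (Q : ℝ) :
    ∑ T, (q T).toReal * (f (y + (1 / θ₀ * θ) • (replaceOn T z w - z))
        + ((1 - θ) * Q + θ * separableReal ψ z
          + 1 / θ₀ * θ * (separableReal ψ (replaceOn T z w) - separableReal ψ z))
        + θ ^ 2 / (2 * θ₀ ^ 2) * weightedSq v (replaceOn T z w - xs)) ≤
      (1 - θ) * (f x + Q) + θ * (f xs + separableReal ψ xs)
        + θ ^ 2 / (2 * θ₀ ^ 2) * weightedSq v (z - xs) := by
  have hn : 0 < (n : ℝ) := by
    rcases Nat.eq_zero_or_pos n with rfl | h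
    · simp [expectedSize, Finset.eq_empty_of_isEmpty] at hτ
    · positivity
  have h0 : 0 < θ₀ := hθ₀ ▸ div_pos hτ hn
  have hψs := hq.sum_replaceOn (fun i t => (ψ i t).untopD 0) z w
  have hvs := hq.sum_replaceOn (fun i t => v i * (t - xs i) ^ 2) z w
  rw [← hθ₀] at hψs hvs
  have hψs' : ∑ T, (q T).toReal * separableReal ψ (replaceOn T z w) =
      (1 - θ₀) * separableReal ψ z + θ₀ * separableReal ψ w := hψs
  have hvs' : ∑ T, (q T).toReal * weightedSq v (replaceOn T z w - xs) =
      (1 - θ₀) * weightedSq v (z - xs) + θ₀ * weightedSq v (w - xs) := by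
    simpa [weightedSq] using hvs
  -- ESO is applied at `y` with the full displacement `(θ/θ₀)(w - z)`; its restriction to `T` is the
  -- actual step.
  have heso := hE y ((1 / θ₀ * θ) • (w - z))
  rw [← hθ₀] at heso
  have hres : ∀ T, restrictTo T ((1 / θ₀ * θ) • (w - z)) =
      (1 / θ₀ * θ) • (replaceOn T z w - z) := by
    intro T
    ext i
    by_cases hi : i ∈ T <;> simp [restrictTo, replaceOn, hi]
  simp_rw [hres] at heso
  have hws : weightedSq v ((1 / θ₀ * θ) • (w - z)) =
      (1 / θ₀ * θ) ^ 2 * weightedSq v (w - z) := by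
    simp only [weightedSq, Finset.mul_sum]
    refine Finset.sum_congr rfl fun i _ => ?_
    simp
    ring
  rw [hws, inner_smul_right] at heso
  have hsum : inner ℝ (gradient f y) (w - y) + θ / (2 * θ₀) * weightedSq v (w - z)
      + separableReal ψ w + θ / (2 * θ₀) * weightedSq v (w - xs) ≤
      inner ℝ (gradient f y) (xs - y) + θ / (2 * θ₀) * weightedSq v (z - xs)
      + separableReal ψ xs := by
    have h := Finset.sum_le_sum fun i (_ : i ∈ Finset.univ) => hw i
    simp only [Finset.sum_add_distrib] at h
    have e1 : ∀ a b : EuclideanSpace ℝ (Fin n),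
        inner ℝ a b = ∑ i, a i * b i := by
      intro a b
      rw [PiLp.inner_apply]
      exact Finset.sum_congr rfl fun i _ => by simp [mul_comm]
    rw [e1, e1]
    simp only [weightedSq, separableReal, Finset.mul_sum, PiLp.sub_apply]
    refine le_trans (le_of_eq ?_) (h.trans (le_of_eq ?_))
    · congr 1
      · congr 2
        exact Finset.sum_congr rfl fun i _ => by ring
      · exact Finset.sum_congr rfl fun i _ => by ring
    · congr 2
      exact Finset.sum_congr rfl fun i _ => by ring
  have hgx := hf.add_inner_gradient_le (hd y) x
  have hgs := hf.add_inner_gradient_le (hd y) xs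
  -- Since `y = (1 - θ) x + θ z`, the linear term splits into one part bounded by convexity at `x`
  -- and one bounded by the subproblem.
  have hinner : θ * inner ℝ (gradient f y) (w - z) =
      (1 - θ) * inner ℝ (gradient f y) (x - y) + θ * inner ℝ (gradient f y) (w - y) := by
    rw [← inner_smul_right, ← inner_smul_right, ← inner_smul_right, ← inner_add_right]
    congr 1
    rw [hy]
    module
  have hlhs : ∑ T, (q T).toReal * (f (y + (1 / θ₀ * θ) • (replaceOn T z w - z))
        + ((1 - θ) * Q + θ * separableReal ψ z
          + 1 / θ₀ * θ * (separableReal ψ (replaceOn T z w) - separableReal ψ z))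
        + θ ^ 2 / (2 * θ₀ ^ 2) * weightedSq v (replaceOn T z w - xs)) =
      ∑ T, (q T).toReal * f (y + (1 / θ₀ * θ) • (replaceOn T z w - z))
        + ((1 - θ) * Q + θ * separableReal ψ z - 1 / θ₀ * θ * separableReal ψ z)
          * ∑ T, (q T).toReal
        + 1 / θ₀ * θ * ∑ T, (q T).toReal * separableReal ψ (replaceOn T z w)
        + θ ^ 2 / (2 * θ₀ ^ 2) * ∑ T, (q T).toReal * weightedSq v (replaceOn T z w - xs) := by
    simp only [Finset.mul_sum]
    rw [← Finset.sum_add_distrib, ← Finset.sum_add_distrib, ← Finset.sum_add_distrib]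
    refine Finset.sum_congr rfl fun T _ => ?_
    ring
  rw [hlhs, q.sum_toReal, hψs', hvs']
  have h2 := mul_le_mul_of_nonneg_left hsum hθ.le
  have h3 := mul_le_mul_of_nonneg_left hgx (sub_nonneg.2 hθ1)
  have h4 := mul_le_mul_of_nonneg_left hgs hθ.le
  have e1 : θ₀ * (1 / θ₀ * θ * inner ℝ (gradient f y) (w - z)
      + 1 / 2 * ((1 / θ₀ * θ) ^ 2 * weightedSq v (w - z))) =
      θ * inner ℝ (gradient f y) (w - z) + θ * (θ / (2 * θ₀) * weightedSq v (w - z)) := by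
    field_simp
  have e2 : 1 / θ₀ * θ * ((1 - θ₀) * separableReal ψ z + θ₀ * separableReal ψ w) =
      1 / θ₀ * θ * separableReal ψ z - θ * separableReal ψ z + θ * separableReal ψ w := by
    field_simp
  have e3 : θ ^ 2 / (2 * θ₀ ^ 2) * ((1 - θ₀) * weightedSq v (z - xs)
      + θ₀ * weightedSq v (w - xs)) = θ ^ 2 / (2 * θ₀ ^ 2) * weightedSq v (z - xs)
      - θ * (θ / (2 * θ₀) * weightedSq v (z - xs))
      + θ * (θ / (2 * θ₀) * weightedSq v (w - xs)) := by
    field_simp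
  rw [e1, hinner] at heso
  rw [e2, e3]
  linarith

/-- The standing assumptions on the composite problem and on the sampling. -/
structure ApproxSetting {n : ℕ} (f : EuclideanSpace ℝ (Fin n) → ℝ) (ψ : Fin n → ℝ → WithTop ℝ)
    (v : Fin n → ℝ) (q : PMF (Finset (Fin n))) (xs : EuclideanSpace ℝ (Fin n)) (τ θ₀ : ℝ) :
    Prop where
  diff : Differentiable ℝ f
  convex : ConvexOn ℝ Set.univ f
  closed : ∀ i, IsClosedConvex (ψ i)
  weight_pos : ∀ i, 0 < v i
  isMin : ∀ x, objective f ψ xs ≤ objective f ψ x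
  min_mem : InDomain ψ xs
  tau_eq : τ = expectedSize q
  tau_pos : 0 < τ
  theta_eq : θ₀ = τ / n
  uniform : IsUniformSampling q
  eso : ESO f q v

namespace ApproxSetting

variable {n : ℕ} {f : EuclideanSpace ℝ (Fin n) → ℝ} {ψ : Fin n → ℝ → WithTop ℝ}
  {v : Fin n → ℝ} {q : PMF (Finset (Fin n))} {xs : EuclideanSpace ℝ (Fin n)} {τ θ₀ : ℝ}

theorem dim_pos (S : ApproxSetting f ψ v q xs τ θ₀) : 0 < (n : ℝ) := by
  have h := S.tau_pos
  rw [S.tau_eq] at h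
  rcases Nat.eq_zero_or_pos n with rfl | hn
  · simp [expectedSize, Finset.eq_empty_of_isEmpty] at h
  · positivity

theorem theta_pos (S : ApproxSetting f ψ v q xs τ θ₀) : 0 < θ₀ := by
  rw [S.theta_eq]
  exact div_pos S.tau_pos S.dim_pos

theorem theta_le_one (S : ApproxSetting f ψ v q xs τ θ₀) : θ₀ ≤ 1 := by
  rw [S.theta_eq, S.tau_eq]
  exact expectedSize_div_le_one

theorem gap_nonneg (S : ApproxSetting f ψ v q xs τ θ₀) {x : EuclideanSpace ℝ (Fin n)}
    (hx : InDomain ψ x) : 0 ≤ objectiveGap f ψ x xs := by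
  have h := S.isMin x
  rw [hx.objective_eq, S.min_mem.objective_eq, WithTop.coe_le_coe] at h
  rw [objectiveGap_eq hx S.min_mem]
  linarith

theorem potential_nonneg (S : ApproxSetting f ψ v q xs τ θ₀) {x : EuclideanSpace ℝ (Fin n)}
    (hx : InDomain ψ x) : 0 ≤ potential f ψ v θ₀ xs x :=
  add_nonneg (mul_nonneg (sub_nonneg.2 S.theta_le_one) (S.gap_nonneg hx))
    (mul_nonneg (by norm_num) (weightedSq_nonneg S.weight_pos _))

theorem convexOn_potential (S : ApproxSetting f ψ v q xs τ θ₀) :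
    ConvexOn ℝ {x | InDomain ψ x} (potential f ψ v θ₀ xs) :=
  _root_.convexOn_potential S.convex S.closed S.weight_pos S.min_mem S.theta_le_one

end ApproxSetting

/-- The state of APPROX without restarts after `k` iterations, started at `x`. -/
noncomputable def approxRun {n : ℕ} (f : EuclideanSpace ℝ (Fin n) → ℝ) (ψ : Fin n → ℝ → WithTop ℝ)
    (v : Fin n → ℝ) (τ : ℝ) (x : EuclideanSpace ℝ (Fin n)) (T : ℕ → Finset (Fin n)) :
    ℕ → ApproxState n
  | 0 => ApproxState.start x
  | k + 1 => approxStep f ψ v τ (T k) (approxRun f ψ v τ x T k)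

/-- The point in which APPROX combines the current `x` and `z`. -/
noncomputable def queryPoint {n : ℕ} (τ : ℝ) (s : ApproxState n) : EuclideanSpace ℝ (Fin n) :=
  (1 - thetaSeq (τ / n) s.age) • s.x + thetaSeq (τ / n) s.age • s.z

/-- The next point `z` when all coordinates are updated. -/
noncomputable def fullStep {n : ℕ} (f : EuclideanSpace ℝ (Fin n) → ℝ) (ψ : Fin n → ℝ → WithTop ℝ)
    (v : Fin n → ℝ) (τ : ℝ) (s : ApproxState n) : EuclideanSpace ℝ (Fin n) :=
  WithLp.toLp 2 fun i => argminReal fun t =>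
    ((gradient f (queryPoint τ s) i * (t - queryPoint τ s i)
      + thetaSeq (τ / n) s.age * n * v i / (2 * τ) * (t - s.z i) ^ 2 : ℝ) : WithTop ℝ) + ψ i t

/-! ### Pathwise bounds for a run without restarts -/

section Run

variable {n : ℕ} {f : EuclideanSpace ℝ (Fin n) → ℝ} {ψ : Fin n → ℝ → WithTop ℝ}
  {v : Fin n → ℝ} {q : PMF (Finset (Fin n))} {xs : EuclideanSpace ℝ (Fin n)} {τ θ₀ : ℝ}

theorem approxStep_z (T : Finset (Fin n)) (s : ApproxState n) :
    (approxStep f ψ v τ T s).z = replaceOn T s.z (fullStep f ψ v τ s) := rfl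

theorem approxStep_x (T : Finset (Fin n)) (s : ApproxState n) :
    (approxStep f ψ v τ T s).x = queryPoint τ s + ((n : ℝ) / τ * thetaSeq (τ / n) s.age) •
      ((approxStep f ψ v τ T s).z - s.z) := by
  simp [ApproxState.x, approxStep, queryPoint]

theorem approxRun_age (x : EuclideanSpace ℝ (Fin n)) (T : ℕ → Finset (Fin n)) (k : ℕ) :
    (approxRun f ψ v τ x T k).age = k := by
  induction k with
  | zero => rfl
  | succ k ih => simp [approxRun, approxStep, ih]

theorem approxRun_hist (x : EuclideanSpace ℝ (Fin n)) (T : ℕ → Finset (Fin n)) {i k : ℕ}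
    (hik : i ≤ k) : (approxRun f ψ v τ x T k).hist i = (approxRun f ψ v τ x T i).x := by
  induction k with
  | zero =>
    obtain rfl : i = 0 := by omega
    rfl
  | succ k ih =>
    rcases hik.lt_or_eq with h | rfl
    · have hne : i ≠ k + 1 := by omega
      rw [← ih (by omega)]
      simp [approxRun, approxStep, approxRun_age, Function.update_of_ne hne]
    · rw [ApproxState.x, approxRun_age]

theorem approxRun_congr (x : EuclideanSpace ℝ (Fin n)) {T T' : ℕ → Finset (Fin n)} {k : ℕ}
    (h : ∀ i < k, T i = T' i) : approxRun f ψ v τ x T k = approxRun f ψ v τ x T' k := by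
  induction k with
  | zero => rfl
  | succ k ih =>
    rw [approxRun, approxRun, ih fun i hi => h i (by omega), h k (by omega)]

theorem approxRun_x_succ (S : ApproxSetting f ψ v q xs τ θ₀) (x : EuclideanSpace ℝ (Fin n))
    (T : ℕ → Finset (Fin n)) (k : ℕ) :
    (approxRun f ψ v τ x T (k + 1)).x =
      (1 - thetaSeq θ₀ k) • (approxRun f ψ v τ x T k).x
        + thetaSeq θ₀ k • (approxRun f ψ v τ x T k).z
        + (1 / θ₀ * thetaSeq θ₀ k) •
          ((approxRun f ψ v τ x T (k + 1)).z - (approxRun f ψ v τ x T k).z) := by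
  have h : (n : ℝ) / τ = 1 / θ₀ := by rw [S.theta_eq, one_div_div]
  rw [approxRun, approxStep_x, queryPoint, approxRun_age, h, ← S.theta_eq]

theorem approxRun_x_eq_sum (S : ApproxSetting f ψ v q xs τ θ₀) (x : EuclideanSpace ℝ (Fin n))
    (T : ℕ → Finset (Fin n)) (k : ℕ) :
    (approxRun f ψ v τ x T k).x =
      ∑ i ∈ Finset.range (k + 1), gammaCoeff θ₀ k i • (approxRun f ψ v τ x T i).z := by
  induction k with
  | zero => simp [gammaCoeff, approxRun, ApproxState.x, ApproxState.start]
  | succ k ih =>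
    rw [approxRun_x_succ S, sum_gammaCoeff_succ S.theta_pos, ih]

theorem fullStep_spec (S : ApproxSetting f ψ v q xs τ θ₀) {s : ApproxState n}
    (hz : InDomain ψ s.z) (i : Fin n) :
    ψ i (fullStep f ψ v τ s i) ≠ ⊤ ∧ ∀ t, ψ i t ≠ ⊤ →
      gradient f (queryPoint τ s) i * (fullStep f ψ v τ s i - queryPoint τ s i)
        + thetaSeq θ₀ s.age / (2 * θ₀) * v i * (fullStep f ψ v τ s i - s.z i) ^ 2
        + (ψ i (fullStep f ψ v τ s i)).untopD 0
        + thetaSeq θ₀ s.age / (2 * θ₀) * v i * (t - fullStep f ψ v τ s i) ^ 2 ≤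
      gradient f (queryPoint τ s) i * (t - queryPoint τ s i)
        + thetaSeq θ₀ s.age / (2 * θ₀) * v i * (t - s.z i) ^ 2 + (ψ i t).untopD 0 := by
  have hc : thetaSeq (τ / n) s.age * n * v i / (2 * τ) = thetaSeq θ₀ s.age / (2 * θ₀) * v i := by
    have hn := S.dim_pos
    have h0 := S.theta_pos
    have hτ : τ = θ₀ * n := by rw [S.theta_eq]; field_simp
    rw [← S.theta_eq, hτ]
    field_simp
  have hpos : 0 < thetaSeq θ₀ s.age / (2 * θ₀) * v i := by
    have h1 := S.theta_pos
    have h2 := thetaSeq_pos h1 s.age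
    have h3 := S.weight_pos i
    positivity
  refine (S.closed i).argminReal_spec (hz i) hpos _ _ _ ?_
  rw [← hc]
  rfl

theorem approxRun_z_mem (S : ApproxSetting f ψ v q xs τ θ₀) {x : EuclideanSpace ℝ (Fin n)}
    (hx : InDomain ψ x) (T : ℕ → Finset (Fin n)) (k : ℕ) :
    InDomain ψ (approxRun f ψ v τ x T k).z := by
  induction k with
  | zero => exact hx
  | succ k ih =>
    intro i
    rw [approxRun, approxStep_z]
    by_cases hi : i ∈ T k
    · simpa [replaceOn, hi] using (fullStep_spec S ih i).1
    · simpa [replaceOn, hi] using ih i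

theorem approxRun_x_mem (S : ApproxSetting f ψ v q xs τ θ₀) {x : EuclideanSpace ℝ (Fin n)}
    (hx : InDomain ψ x) (T : ℕ → Finset (Fin n)) (k : ℕ) :
    InDomain ψ (approxRun f ψ v τ x T k).x := by
  rw [approxRun_x_eq_sum S]
  exact (convexOn_separableReal S.closed).1.sum_mem
    (fun i _ => gammaCoeff_nonneg S.theta_pos S.theta_le_one k i) (sum_gammaCoeff S.theta_pos k)
    fun i _ => approxRun_z_mem S hx T i

/-- The Lyapunov function `θ₀²/θ_{k-1}² (F̂_k - F(x⋆)) + ½ ‖z_k - x⋆‖_v²` of APPROX, where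
`F̂_k = f(x_k) + ∑ i ≤ k, γ_k^i ψ(z_i)`. -/
noncomputable def lyapunov (f : EuclideanSpace ℝ (Fin n) → ℝ) (ψ : Fin n → ℝ → WithTop ℝ)
    (v : Fin n → ℝ) (τ θ₀ : ℝ) (xs x : EuclideanSpace ℝ (Fin n)) (k : ℕ)
    (T : ℕ → Finset (Fin n)) : ℝ :=
  θ₀ ^ 2 * invThetaPrevSq θ₀ k * (f (approxRun f ψ v τ x T k).x
    + ∑ i ∈ Finset.range (k + 1), gammaCoeff θ₀ k i * separableReal ψ (approxRun f ψ v τ x T i).z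
    - (f xs + separableReal ψ xs)) + 1 / 2 * weightedSq v ((approxRun f ψ v τ x T k).z - xs)

theorem lyapunov_zero (S : ApproxSetting f ψ v q xs τ θ₀) {x : EuclideanSpace ℝ (Fin n)}
    (hx : InDomain ψ x) (T : ℕ → Finset (Fin n)) :
    lyapunov f ψ v τ θ₀ xs x 0 T = potential f ψ v θ₀ xs x := by
  have h := S.theta_pos
  simp only [lyapunov, potential, approxRun, ApproxState.start, ApproxState.x, invThetaPrevSq,
    objectiveGap_eq hx S.min_mem]
  simp [gammaCoeff]
  field_simp
  simp only [mul_eq_mul_left_iff, sub_left_inj, add_right_inj]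
  exact Or.inl rfl

theorem lyapunov_congr (x : EuclideanSpace ℝ (Fin n)) {T T' : ℕ → Finset (Fin n)} {k : ℕ}
    (h : ∀ i < k, T i = T' i) :
    lyapunov f ψ v τ θ₀ xs x k T = lyapunov f ψ v τ θ₀ xs x k T' := by
  have hz : ∀ i ∈ Finset.range (k + 1), gammaCoeff θ₀ k i *
      separableReal ψ (approxRun f ψ v τ x T i).z =
      gammaCoeff θ₀ k i * separableReal ψ (approxRun f ψ v τ x T' i).z := by
    intro i hi
    rw [approxRun_congr x fun j hj => h j (by simp at hi; omega)]
  rw [lyapunov, lyapunov, Finset.sum_congr rfl hz, approxRun_congr x h]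

/-- In expectation over the next set of coordinates, the Lyapunov function does not increase. -/
theorem sum_lyapunov_update_le (S : ApproxSetting f ψ v q xs τ θ₀)
    {x : EuclideanSpace ℝ (Fin n)} (hx : InDomain ψ x) (k : ℕ) (T : ℕ → Finset (Fin n)) :
    ∑ A, (q A).toReal * lyapunov f ψ v τ θ₀ xs x (k + 1) (Function.update T k A) ≤
      lyapunov f ψ v τ θ₀ xs x k T := by
  have h0 := S.theta_pos
  have hp := thetaSeq_pos h0 k
  have hle := (thetaSeq_le h0 k).trans S.theta_le_one
  set s := approxRun f ψ v τ x T k with hs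
  have hage : s.age = k := approxRun_age x T k
  have hz : InDomain ψ s.z := approxRun_z_mem S hx T k
  have hrun : ∀ A, ∀ i ≤ k, approxRun f ψ v τ x (Function.update T k A) i =
      approxRun f ψ v τ x T i := fun A i hi =>
    approxRun_congr x fun j hj => Function.update_of_ne (by omega) _ _
  have hrun' : ∀ A, approxRun f ψ v τ x (Function.update T k A) (k + 1) =
      approxStep f ψ v τ A s := by
    intro A
    rw [approxRun, hrun A k le_rfl, Function.update_self]
  set Q := ∑ i ∈ Finset.range (k + 1), gammaCoeff θ₀ k i *
    separableReal ψ (approxRun f ψ v τ x T i).z with hQ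
  have hw := fun i => (fullStep_spec S hz i).2 (xs i) (S.min_mem i)
  rw [hage] at hw
  have key := approx_one_step S.convex S.diff S.uniform S.eso (S.tau_eq ▸ S.tau_pos)
    (S.theta_eq.trans (by rw [S.tau_eq])) hp hle
    (x := s.x) (y := queryPoint τ s) (z := s.z) (by rw [queryPoint, hage, S.theta_eq]) hw Q
  have hterm : ∀ A, lyapunov f ψ v τ θ₀ xs x (k + 1) (Function.update T k A) =
      θ₀ ^ 2 / thetaSeq θ₀ k ^ 2 *
      ((f (queryPoint τ s + (1 / θ₀ * thetaSeq θ₀ k) •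
            (replaceOn A s.z (fullStep f ψ v τ s) - s.z))
        + ((1 - thetaSeq θ₀ k) * Q + thetaSeq θ₀ k * separableReal ψ s.z
          + 1 / θ₀ * thetaSeq θ₀ k *
            (separableReal ψ (replaceOn A s.z (fullStep f ψ v τ s)) - separableReal ψ s.z))
        + thetaSeq θ₀ k ^ 2 / (2 * θ₀ ^ 2) *
            weightedSq v (replaceOn A s.z (fullStep f ψ v τ s) - xs))
        - (f xs + separableReal ψ xs)) := by
    intro A
    have hsum := sum_gammaCoeff_succ h0
      (fun i => separableReal ψ (approxRun f ψ v τ x (Function.update T k A) i).z) k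
    have hlow : ∑ i ∈ Finset.range (k + 1), gammaCoeff θ₀ k i *
        separableReal ψ (approxRun f ψ v τ x (Function.update T k A) i).z = Q := by
      refine Finset.sum_congr rfl fun i hi => ?_
      rw [hrun A i (by simp at hi; omega)]
    simp only [smul_eq_mul] at hsum
    rw [hlow, hrun A k le_rfl, hrun' A, approxStep_z] at hsum
    have hx' : (approxStep f ψ v τ A s).x = queryPoint τ s + (1 / θ₀ * thetaSeq θ₀ k) •
        (replaceOn A s.z (fullStep f ψ v τ s) - s.z) := by
      rw [approxStep_x, approxStep_z, hage, ← S.theta_eq]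
      congr 3
      rw [S.theta_eq, one_div_div]
    rw [lyapunov, hsum, hrun' A, hx', approxStep_z, invThetaPrevSq]
    field_simp
    ring
  simp_rw [hterm]
  have hcalc : ∀ g : Finset (Fin n) → ℝ, ∀ c d : ℝ, ∑ A, (q A).toReal * (c * (g A - d)) =
      c * (∑ A, (q A).toReal * g A - d) := by
    intro g c d
    have e : ∀ A, (q A).toReal * (c * (g A - d)) =
        c * ((q A).toReal * g A) - (q A).toReal * (c * d) := fun A => by ring
    simp_rw [e]
    rw [Finset.sum_sub_distrib, ← Finset.mul_sum, ← Finset.sum_mul, q.sum_toReal]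
    ring
  rw [hcalc]
  refine (mul_le_mul_of_nonneg_left (sub_le_sub_right key _) (by positivity)).trans (le_of_eq ?_)
  -- The factor `(1 - θ_k)/θ_k²` left by the one-step bound equals `1/θ_{k-1}²`, the weight in the
  -- Lyapunov function at step `k`.
  rw [lyapunov, invThetaPrevSq_eq h0]
  field_simp
  ring

/-- Jensen's inequality for `ψ`, because `x_k` is the `γ_k`-average of the `z_i`. -/
theorem objectiveGap_run_le (S : ApproxSetting f ψ v q xs τ θ₀) {x : EuclideanSpace ℝ (Fin n)}
    (hx : InDomain ψ x) (T : ℕ → Finset (Fin n)) (k : ℕ) :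
    objectiveGap f ψ (approxRun f ψ v τ x T k).x xs ≤ f (approxRun f ψ v τ x T k).x
    + ∑ i ∈ Finset.range (k + 1), gammaCoeff θ₀ k i * separableReal ψ (approxRun f ψ v τ x T i).z
    - (f xs + separableReal ψ xs) := by
  rw [objectiveGap_eq (approxRun_x_mem S hx T k) S.min_mem]
  have h := (convexOn_separableReal S.closed).map_sum_le (t := Finset.range (k + 1))
    (fun i _ => gammaCoeff_nonneg S.theta_pos S.theta_le_one k i) (sum_gammaCoeff S.theta_pos k)
    (fun i _ => approxRun_z_mem S hx T i)
  rw [← approxRun_x_eq_sum S] at h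
  simp only [smul_eq_mul] at h
  linarith

/-- Jensen's inequality for the squared distance; each `½‖z_i - x⋆‖_v²` is then the Lyapunov
function minus its weighted gap term, which dominates the true gap. -/
theorem half_weightedSq_run_le (S : ApproxSetting f ψ v q xs τ θ₀)
    {x : EuclideanSpace ℝ (Fin n)} (hx : InDomain ψ x) (T : ℕ → Finset (Fin n)) (k : ℕ) :
    1 / 2 * weightedSq v ((approxRun f ψ v τ x T k).x - xs) ≤
      ∑ i ∈ Finset.range (k + 1), gammaCoeff θ₀ k i * lyapunov f ψ v τ θ₀ xs x i T
      - θ₀ ^ 2 * ∑ i ∈ Finset.range (k + 1), gammaCoeff θ₀ k i * invThetaPrevSq θ₀ i *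
          objectiveGap f ψ (approxRun f ψ v τ x T i).x xs := by
  have h := (convexOn_weightedSq_sub S.weight_pos xs).map_sum_le (t := Finset.range (k + 1))
    (fun i _ => gammaCoeff_nonneg S.theta_pos S.theta_le_one k i) (sum_gammaCoeff S.theta_pos k)
    (p := fun i => (approxRun f ψ v τ x T i).z) (fun i _ => Set.mem_univ _)
  rw [← approxRun_x_eq_sum S] at h
  refine (mul_le_mul_of_nonneg_left h (by norm_num)).trans ?_
  rw [Finset.mul_sum, Finset.mul_sum, ← Finset.sum_sub_distrib]
  refine Finset.sum_le_sum fun i _ => ?_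
  have hg := gammaCoeff_nonneg S.theta_pos S.theta_le_one k i
  have ha := invThetaPrevSq_nonneg S.theta_pos S.theta_le_one i
  have hgap := mul_le_mul_of_nonneg_left (objectiveGap_run_le S hx T i)
    (mul_nonneg (mul_nonneg (sq_nonneg θ₀) hg) ha)
  rw [lyapunov, smul_eq_mul]
  linarith

/-- Jensen's inequality with the weights of the center point. Stated for a general convex function,
since it serves for the gap, for the potential and for membership in the domain. -/
theorem totalWeight_mul_centerPoint_le (S : ApproxSetting f ψ v q xs τ θ₀)
    {s : Set (EuclideanSpace ℝ (Fin n))} {g : EuclideanSpace ℝ (Fin n) → ℝ}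
    (hg : ConvexOn ℝ s g) {X : ℕ → EuclideanSpace ℝ (Fin n)} {k : ℕ} (hX : ∀ i ≤ k, X i ∈ s) :
    centerPoint θ₀ X k ∈ s ∧ totalWeight θ₀ k * g (centerPoint θ₀ X k) ≤
      ∑ i ∈ Finset.range k, gammaCoeff θ₀ k i * invThetaPrevSq θ₀ i * g (X i)
        + lastWeight θ₀ k * g (X k) := by
  have hW := totalWeight_pos S.theta_pos S.theta_le_one k
  let w : ℕ → ℝ := fun i => (if i = k then lastWeight θ₀ k else
    gammaCoeff θ₀ k i * invThetaPrevSq θ₀ i) / totalWeight θ₀ k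
  have hwk : ∀ i ∈ Finset.range k,
      w i = gammaCoeff θ₀ k i * invThetaPrevSq θ₀ i / totalWeight θ₀ k := by
    intro i hi
    have : i ≠ k := by simp at hi; omega
    simp [w, this]
  have hw0 : ∀ i ∈ Finset.range (k + 1), 0 ≤ w i := by
    intro i _
    refine div_nonneg ?_ hW.le
    split_ifs
    · exact (lastWeight_pos S.theta_pos k).le
    · exact mul_nonneg (gammaCoeff_nonneg S.theta_pos S.theta_le_one k i)
        (invThetaPrevSq_nonneg S.theta_pos S.theta_le_one i)
  have hw1 : ∑ i ∈ Finset.range (k + 1), w i = 1 := by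
    rw [Finset.sum_range_succ, Finset.sum_congr rfl hwk, ← Finset.sum_div]
    simp only [w, if_true]
    rw [← add_div]
    exact div_self hW.ne'
  have hXs : ∀ i ∈ Finset.range (k + 1), X i ∈ s := fun i hi => hX i (by simp at hi; omega)
  have hc : centerPoint θ₀ X k = ∑ i ∈ Finset.range (k + 1), w i • X i := by
    rw [Finset.sum_range_succ, Finset.sum_congr rfl fun i hi => by rw [hwk i hi], centerPoint,
      smul_add, Finset.smul_sum]
    simp only [w, if_true, smul_smul]
    simp only [one_div_mul_eq_div]
  rw [hc]
  refine ⟨hg.1.sum_mem hw0 hw1 hXs, ?_⟩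
  refine (mul_le_mul_of_nonneg_left (hg.map_sum_le hw0 hw1 hXs) hW.le).trans (le_of_eq ?_)
  rw [Finset.sum_range_succ, Finset.sum_congr rfl fun i hi => by rw [hwk i hi], mul_add,
    Finset.mul_sum]
  simp only [w, if_true, smul_eq_mul]
  congr 1
  · refine Finset.sum_congr rfl fun i _ => ?_
    field_simp
  · field_simp

/-- The pathwise bound on the potential of an iterate and the gap at the center point. -/
theorem potential_add_gap_le (S : ApproxSetting f ψ v q xs τ θ₀)
    {x : EuclideanSpace ℝ (Fin n)} (hx : InDomain ψ x) (T : ℕ → Finset (Fin n)) {k : ℕ}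
    (hk : 1 ≤ k) :
    potential f ψ v θ₀ xs (approxRun f ψ v τ x T k).x + θ₀ ^ 2 * totalWeight θ₀ k *
        objectiveGap f ψ (centerPoint θ₀ (fun i => (approxRun f ψ v τ x T i).x) k) xs ≤
      ∑ i ∈ Finset.range (k + 1), gammaCoeff θ₀ k i * lyapunov f ψ v τ θ₀ xs x i T := by
  have h1 := half_weightedSq_run_le S hx T k
  have h2 := (totalWeight_mul_centerPoint_le S (convexOn_objectiveGap S.convex S.closed S.min_mem)
    (X := fun i => (approxRun f ψ v τ x T i).x) (k := k)
    fun i _ => approxRun_x_mem S hx T i).2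
  have h3 := mul_le_mul_of_nonneg_left h2 (sq_nonneg θ₀)
  -- The weight of the last gap is split: `lastWeight` goes to the center point, the rest becomes
  -- the gap term of the potential.
  rw [Finset.sum_range_succ _ k, Finset.sum_range_succ _ k,
    gammaCoeff_self_mul S.theta_pos hk] at h1
  have h0 := S.theta_pos
  have e : θ₀ ^ 2 * ((1 - θ₀) / θ₀ ^ 2) = 1 - θ₀ := by field_simp
  rw [Finset.sum_range_succ, potential, ← e]
  linarith

end Run

instance Finset.measurableSingletonClass {α : Type*} [Countable α] :
    MeasurableSingletonClass (Finset α) where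
  measurableSet_singleton T := by
    rw [measurableSet_finset_iff]
    refine ⟨{(T : Set α)}, measurableSet_singleton _, ?_⟩
    ext s
    simp

/-! ### Integration over independent draws -/

section Sampling

theorem dependsOn_update {A B : Type*} {k : ℕ} {G : (ℕ → A) → B}
    (hG : DependsOn G (Set.Iio (k + 1))) (a : A) :
    DependsOn (fun T => G (Function.update T k a)) (Set.Iio k) := by
  intro T T' h
  refine hG fun i hi => ?_
  rcases eq_or_ne i k with rfl | hne
  · simp
  · rw [Function.update_of_ne hne, Function.update_of_ne hne]
    exact h i (by simp at hi ⊢; omega)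

variable {A Ω : Type*} [Fintype A] [Inhabited A] [MeasurableSpace A]
  [MeasurableSingletonClass A] [MeasurableSpace Ω] {P : Measure Ω} [IsProbabilityMeasure P]
  {S : ℕ → Ω → A}

/-- The function of `T 0, …, T (k - 1)` through which a function of the whole sequence that does
not depend on the later terms factors. -/
def restrictToPrefix {A B : Type*} [Inhabited A] (k : ℕ) (G : (ℕ → A) → B)
    (w : Finset.range k → A) : B :=
  G fun j => if h : j ∈ Finset.range k then w ⟨j, h⟩ else default

theorem restrictToPrefix_apply {A B : Type*} [Inhabited A] {k : ℕ} {G : (ℕ → A) → B}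
    (hG : DependsOn G (Set.Iio k)) (T : ℕ → A) :
    restrictToPrefix k G (fun j => T j) = G T := by
  refine hG fun i hi => ?_
  have : i ∈ Finset.range k := by simpa using hi
  simp only [this, dite_true]

/-- Only finitely many values can occur, as `A` is finite and `G` sees finitely many draws. -/
theorem integrable_of_dependsOn (hS : ∀ k, Measurable (S k)) {k : ℕ} {G : (ℕ → A) → ℝ}
    (hG : DependsOn G (Set.Iio k)) : Integrable (fun ω => G fun j => S j ω) P := by
  have hW : Measurable fun ω => fun j : Finset.range k => S j ω :=
    measurable_pi_lambda _ fun j => hS j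
  have h : Integrable (restrictToPrefix k G) (P.map fun ω => fun j : Finset.range k => S j ω) :=
    have := Measure.isProbabilityMeasure_map (μ := P) hW.aemeasurable
    Integrable.of_finite
  exact (h.comp_measurable hW).congr
    (Filter.Eventually.of_forall fun ω => restrictToPrefix_apply hG fun j => S j ω)

/-- The last of `k + 1` independent variables can be integrated out. -/
theorem integral_dependsOn_succ [DecidableEq A] {p : A → ℝ} (hS : ∀ k, Measurable (S k))
    (hind : iIndepFun S P) (hlaw : ∀ k a, P.real {ω | S k ω = a} = p a) {k : ℕ}
    {G : (ℕ → A) → ℝ} (hG : DependsOn G (Set.Iio (k + 1))) :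
    ∫ ω, G (fun j => S j ω) ∂P =
      ∫ ω, ∑ a, p a * G (Function.update (fun j => S j ω) k a) ∂P := by
  have hint : ∀ a, Integrable (fun ω => G (Function.update (fun j => S j ω) k a)) P := fun a =>
    integrable_of_dependsOn hS (dependsOn_update hG a)
  have hterm : ∀ a, ∫ ω, (if S k ω = a then (1 : ℝ) else 0) *
      G (Function.update (fun j => S j ω) k a) ∂P =
      p a * ∫ ω, G (Function.update (fun j => S j ω) k a) ∂P := by
    intro a
    have hi : IndepFun (fun ω => fun j : ({k} : Finset ℕ) => S j ω)
        (fun ω => fun j : Finset.range k => S j ω) P :=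
      hind.indepFun_finset {k} (Finset.range k) (by simp) hS
    have hi2 : IndepFun (fun ω => if S k ω = a then (1 : ℝ) else 0)
        (fun ω => G (Function.update (fun j => S j ω) k a)) P := by
      have h := hi.comp (φ := fun w => if w ⟨k, by simp⟩ = a then (1 : ℝ) else 0)
        (ψ := restrictToPrefix k fun T => G (Function.update T k a))
        (measurable_of_countable _) (measurable_of_countable _)
      refine h.congr (Filter.Eventually.of_forall fun ω => rfl)
        (Filter.Eventually.of_forall fun ω => ?_)
      exact restrictToPrefix_apply (dependsOn_update hG a) fun j => S j ω
    have hm : Measurable fun ω => if S k ω = a then (1 : ℝ) else 0 :=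
      (measurable_of_countable fun b : A => if b = a then (1 : ℝ) else 0).comp (hS k)
    rw [hi2.integral_fun_mul_eq_mul_integral hm.aestronglyMeasurable
      (hint a).aestronglyMeasurable]
    congr 1
    rw [← hlaw k a]
    have hset : MeasurableSet {ω | S k ω = a} := hS k (measurableSet_singleton a)
    rw [← integral_indicator_one hset]
    exact integral_congr_ae (Filter.Eventually.of_forall fun ω => by
      simp [Set.indicator_apply])
  -- Expanding over the value of draw `k` leaves products of an indicator of that draw and a
  -- function of the earlier ones, which are independent.
  have hsplit : ∀ ω, G (fun j => S j ω) = ∑ a, (if S k ω = a then (1 : ℝ) else 0) *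
      G (Function.update (fun j => S j ω) k a) := by
    intro ω
    simp
  have hint' : ∀ a, Integrable (fun ω => (if S k ω = a then (1 : ℝ) else 0) *
      G (Function.update (fun j => S j ω) k a)) P := by
    intro a
    have hdep : DependsOn (fun T : ℕ → A => (if T k = a then (1 : ℝ) else 0) *
        G (Function.update T k a)) (Set.Iio (k + 1)) := by
      intro T T' h
      have h1 := dependsOn_update hG a (x := T) (y := T') fun i hi =>
        h i (by simp at hi ⊢; omega)
      simp only at h1 ⊢
      rw [h1, h k (by simp)]
    exact integrable_of_dependsOn hS hdep
  simp_rw [hsplit]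
  rw [integral_finsetSum _ fun a _ => hint' a]
  rw [integral_finsetSum _ fun a _ => (by simpa using (hint a).const_mul (p a))]
  refine Finset.sum_congr rfl fun a _ => ?_
  rw [integral_const_mul]
  exact hterm a

theorem integral_le_of_sum_update_le [DecidableEq A] {p : A → ℝ} (hS : ∀ k, Measurable (S k))
    (hind : iIndepFun S P) (hlaw : ∀ k a, P.real {ω | S k ω = a} = p a) {k : ℕ}
    {G H : (ℕ → A) → ℝ} (hG : DependsOn G (Set.Iio (k + 1))) (hH : DependsOn H (Set.Iio k))
    (hGH : ∀ T, ∑ a, p a * G (Function.update T k a) ≤ H T) :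
    ∫ ω, G (fun j => S j ω) ∂P ≤ ∫ ω, H (fun j => S j ω) ∂P := by
  rw [integral_dependsOn_succ hS hind hlaw hG]
  exact integral_mono (integrable_finsetSum _ fun a _ =>
    (integrable_of_dependsOn hS (dependsOn_update hG a)).const_mul _)
    (integrable_of_dependsOn hS hH) fun ω => hGH _

end Sampling

section Coefficients

theorem DependsOn.comp_left {ι B C : Type*} {α : ι → Type*} {s : Set ι}
    {g : (∀ i, α i) → B} (hg : DependsOn g s) (φ : B → C) : DependsOn (fun T => φ (g T)) s :=
  fun _ _ h => congrArg φ (hg h)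

theorem centerPoint_congr {n : ℕ} {θ₀ : ℝ} {X Y : ℕ → EuclideanSpace ℝ (Fin n)} {k : ℕ}
    (h : ∀ i ≤ k, X i = Y i) : centerPoint θ₀ X k = centerPoint θ₀ Y k := by
  have hs : ∑ i ∈ Finset.range k, (gammaCoeff θ₀ k i * invThetaPrevSq θ₀ i) • X i =
      ∑ i ∈ Finset.range k, (gammaCoeff θ₀ k i * invThetaPrevSq θ₀ i) • Y i :=
    Finset.sum_congr rfl fun i hi => by rw [h i (by simp at hi; omega)]
  rw [centerPoint, centerPoint, hs, h k le_rfl]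

theorem restartPoint_congr {n : ℕ} {θ₀ σ : ℝ} {X Y : ℕ → EuclideanSpace ℝ (Fin n)} {k : ℕ}
    (h : ∀ i ≤ k, X i = Y i) : restartPoint θ₀ σ X k = restartPoint θ₀ σ Y k := by
  rw [restartPoint, restartPoint, h k le_rfl, centerPoint_congr h]

/-- The denominator is now the constant that compares the potential with the gap under growth of
modulus `μ`. -/
theorem mCoeff_eq {θ₀ μ : ℝ} (hμ : 0 < μ) (k : ℕ) :
    mCoeff θ₀ k μ = θ₀ ^ 2 * totalWeight θ₀ k / (1 / μ + (1 - θ₀)) := by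
  have : 1 / μ + (1 - θ₀) = (1 + μ * (1 - θ₀)) / μ := by field_simp
  rw [mCoeff, this, div_div_eq_mul_div]
  ring

theorem mCoeff_pos {θ₀ μ : ℝ} (h0 : 0 < θ₀) (h1 : θ₀ ≤ 1) (hμ : 0 < μ) (k : ℕ) :
    0 < mCoeff θ₀ k μ := by
  have h := totalWeight_pos h0 h1 k
  have h2 : 0 ≤ 1 - θ₀ := by linarith
  rw [mCoeff_eq hμ]
  positivity

end Coefficients

/-! ### Expected bounds for one run and one restart -/

section Expectation

variable {n : ℕ} {f : EuclideanSpace ℝ (Fin n) → ℝ} {ψ : Fin n → ℝ → WithTop ℝ}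
  {v : Fin n → ℝ} {q : PMF (Finset (Fin n))} {xs : EuclideanSpace ℝ (Fin n)} {τ θ₀ : ℝ}

theorem dependsOn_approxRun {t k : ℕ} {x : (ℕ → Finset (Fin n)) → EuclideanSpace ℝ (Fin n)}
    (hx : DependsOn x (Set.Iio t)) :
    DependsOn (fun T => approxRun f ψ v τ (x T) (fun j => T (t + j)) k) (Set.Iio (t + k)) := by
  intro T T' h
  have h1 : x T = x T' := hx fun i hi => h i (by simp at hi ⊢; omega)
  simp only [h1]
  exact approxRun_congr _ fun i hi => h (t + i) (by simp; omega)

theorem dependsOn_approxRun_x_of_le {t i k : ℕ}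
    {x : (ℕ → Finset (Fin n)) → EuclideanSpace ℝ (Fin n)}
    (hx : DependsOn x (Set.Iio t)) (hik : i ≤ k) :
    DependsOn (fun T => (approxRun f ψ v τ (x T) (fun j => T (t + j)) i).x) (Set.Iio (t + k)) :=
  ((dependsOn_approxRun hx).comp_left ApproxState.x).mono
    (Set.Iio_subset_Iio (Nat.add_le_add_left hik t))

theorem dependsOn_centerPoint {t k : ℕ}
    {x : (ℕ → Finset (Fin n)) → EuclideanSpace ℝ (Fin n)} (hx : DependsOn x (Set.Iio t)) :
    DependsOn (fun T => centerPoint θ₀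
      (fun i => (approxRun f ψ v τ (x T) (fun j => T (t + j)) i).x) k) (Set.Iio (t + k)) :=
  fun _ _ h => centerPoint_congr fun _ hi => dependsOn_approxRun_x_of_le hx hi h

theorem dependsOn_restartPoint {t k : ℕ} {σ : ℝ}
    {x : (ℕ → Finset (Fin n)) → EuclideanSpace ℝ (Fin n)} (hx : DependsOn x (Set.Iio t)) :
    DependsOn (fun T => restartPoint θ₀ σ
      (fun i => (approxRun f ψ v τ (x T) (fun j => T (t + j)) i).x) k) (Set.Iio (t + k)) :=
  fun _ _ h => restartPoint_congr fun _ hi => dependsOn_approxRun_x_of_le hx hi h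

theorem dependsOn_lyapunov {t k : ℕ} {x : (ℕ → Finset (Fin n)) → EuclideanSpace ℝ (Fin n)}
    (hx : DependsOn x (Set.Iio t)) :
    DependsOn (fun T => lyapunov f ψ v τ θ₀ xs (x T) k fun j => T (t + j)) (Set.Iio (t + k)) := by
  intro T T' h
  have h1 : x T = x T' := hx fun i hi => h i (by simp at hi ⊢; omega)
  simp only [h1]
  exact lyapunov_congr _ fun i hi => h (t + i) (by simp; omega)

variable {Ω : Type*} [MeasurableSpace Ω] {P : Measure Ω} [IsProbabilityMeasure P]
  {S : ℕ → Ω → Finset (Fin n)} {t : ℕ}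
  {x : (ℕ → Finset (Fin n)) → EuclideanSpace ℝ (Fin n)}

/-- The starting point may be random, but it depends only on the draws before time `t`, while the
run uses the draws from `t` on. The one-step inequality can therefore be integrated draw by draw. -/
theorem integral_lyapunov_le (A : ApproxSetting f ψ v q xs τ θ₀) (hS : ∀ k, Measurable (S k))
    (hind : iIndepFun S P) (hlaw : ∀ k T, P.real {ω | S k ω = T} = (q T).toReal)
    (hx : DependsOn x (Set.Iio t)) (hxd : ∀ T, InDomain ψ (x T)) (k : ℕ) :
    ∫ ω, lyapunov f ψ v τ θ₀ xs (x fun j => S j ω) k (fun j => S (t + j) ω) ∂P ≤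
      ∫ ω, potential f ψ v θ₀ xs (x fun j => S j ω) ∂P := by
  induction k with
  | zero => simp only [lyapunov_zero A (hxd _), le_rfl]
  | succ k ih =>
    refine le_trans ?_ ih
    refine integral_le_of_sum_update_le (p := fun T => (q T).toReal) hS hind hlaw (k := t + k)
      (G := fun T => lyapunov f ψ v τ θ₀ xs (x T) (k + 1) fun j => T (t + j))
      (H := fun T => lyapunov f ψ v τ θ₀ xs (x T) k fun j => T (t + j))
      (dependsOn_lyapunov hx) (dependsOn_lyapunov hx) fun T => ?_
    refine le_trans (le_of_eq ?_)
      (sum_lyapunov_update_le A (hxd T) k fun j => T (t + j))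
    refine Finset.sum_congr rfl fun a _ => ?_
    have h1 : x (Function.update T (t + k) a) = x T :=
      hx fun i hi => Function.update_of_ne (by simp at hi; omega) _ _
    have h2 : (fun j => Function.update T (t + k) a (t + j)) =
        Function.update (fun j => T (t + j)) k a := by
      ext1 j
      simp [Function.update_apply]
    simp only [h1, h2]

theorem integral_potential_add_gap_le (A : ApproxSetting f ψ v q xs τ θ₀)
    (hS : ∀ k, Measurable (S k))
    (hind : iIndepFun S P) (hlaw : ∀ k T, P.real {ω | S k ω = T} = (q T).toReal)
    (hx : DependsOn x (Set.Iio t)) (hxd : ∀ T, InDomain ψ (x T)) {k : ℕ} (hk : 1 ≤ k) :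
    ∫ ω, potential f ψ v θ₀ xs
        (approxRun f ψ v τ (x fun j => S j ω) (fun j => S (t + j) ω) k).x ∂P
      + θ₀ ^ 2 * totalWeight θ₀ k * ∫ ω, objectiveGap f ψ (centerPoint θ₀ (fun i =>
        (approxRun f ψ v τ (x fun j => S j ω) (fun j => S (t + j) ω) i).x) k) xs ∂P ≤
      ∫ ω, potential f ψ v θ₀ xs (x fun j => S j ω) ∂P := by
  have i1 := integrable_of_dependsOn (P := P) hS
    ((dependsOn_approxRun_x_of_le (f := f) (ψ := ψ) (v := v) (τ := τ) hx
      (le_refl k)).comp_left (potential f ψ v θ₀ xs))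
  have i2 := integrable_of_dependsOn (P := P) hS
    ((dependsOn_centerPoint (θ₀ := θ₀) (f := f) (ψ := ψ) (v := v) (τ := τ) (k := k)
      hx).comp_left fun y => objectiveGap f ψ y xs)
  have i3 := fun i => integrable_of_dependsOn (P := P) hS
    (dependsOn_lyapunov (θ₀ := θ₀) (xs := xs) (f := f) (ψ := ψ) (v := v) (τ := τ) (k := i) hx)
  rw [← integral_const_mul, ← integral_add i1 (i2.const_mul _)]
  refine (integral_mono (i1.add (i2.const_mul _))
    (integrable_finsetSum (Finset.range (k + 1))
      fun i _ => (i3 i).const_mul (gammaCoeff θ₀ k i)) fun ω =>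
    potential_add_gap_le A (hxd _) (fun j => S (t + j) ω) hk).trans ?_
  rw [integral_finsetSum _ fun i _ => (i3 i).const_mul _]
  calc _ ≤ ∑ i ∈ Finset.range (k + 1), gammaCoeff θ₀ k i *
        ∫ ω, potential f ψ v θ₀ xs (x fun j => S j ω) ∂P := by
        refine Finset.sum_le_sum fun i _ => ?_
        rw [integral_const_mul]
        exact mul_le_mul_of_nonneg_left (integral_lyapunov_le A hS hind hlaw hx hxd i)
          (gammaCoeff_nonneg A.theta_pos A.theta_le_one k i)
    _ = _ := by rw [← Finset.sum_mul, sum_gammaCoeff A.theta_pos, one_mul]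

theorem centerPoint_run_mem (A : ApproxSetting f ψ v q xs τ θ₀) {y : EuclideanSpace ℝ (Fin n)}
    (hy : InDomain ψ y) (T : ℕ → Finset (Fin n)) (k : ℕ) :
    InDomain ψ (centerPoint θ₀ (fun i => (approxRun f ψ v τ y T i).x) k) :=
  (totalWeight_mul_centerPoint_le A (convexOn_separableReal A.closed)
    fun i _ => approxRun_x_mem A hy T i).1

theorem restartPoint_run_mem (A : ApproxSetting f ψ v q xs τ θ₀) {y : EuclideanSpace ℝ (Fin n)}
    (hy : InDomain ψ y) (T : ℕ → Finset (Fin n)) (k : ℕ) {σ : ℝ} (hσ0 : 0 ≤ σ) (hσ1 : σ ≤ 1) :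
    InDomain ψ (restartPoint θ₀ σ (fun i => (approxRun f ψ v τ y T i).x) k) :=
  (convexOn_separableReal A.closed).1 (approxRun_x_mem A hy T k) (centerPoint_run_mem A hy T k)
    hσ0 (sub_nonneg.2 hσ1) (by ring)

theorem integral_potential_run_le (A : ApproxSetting f ψ v q xs τ θ₀)
    (hS : ∀ k, Measurable (S k))
    (hind : iIndepFun S P) (hlaw : ∀ k T, P.real {ω | S k ω = T} = (q T).toReal)
    (hx : DependsOn x (Set.Iio t)) (hxd : ∀ T, InDomain ψ (x T)) (k : ℕ) :
    ∫ ω, potential f ψ v θ₀ xs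
        (approxRun f ψ v τ (x fun j => S j ω) (fun j => S (t + j) ω) k).x ∂P ≤
      ∫ ω, potential f ψ v θ₀ xs (x fun j => S j ω) ∂P := by
  rcases Nat.eq_zero_or_pos k with rfl | hk
  · exact le_rfl
  · refine le_trans ?_ (integral_potential_add_gap_le A hS hind hlaw hx hxd hk)
    refine le_add_of_nonneg_right (mul_nonneg ?_ (integral_nonneg fun ω => ?_))
    · exact mul_nonneg (sq_nonneg _) (totalWeight_pos A.theta_pos A.theta_le_one k).le
    · exact A.gap_nonneg (centerPoint_run_mem A (hxd _) _ k)

theorem integral_potential_centerPoint_le (A : ApproxSetting f ψ v q xs τ θ₀)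
    (hS : ∀ k, Measurable (S k))
    (hind : iIndepFun S P) (hlaw : ∀ k T, P.real {ω | S k ω = T} = (q T).toReal)
    (hx : DependsOn x (Set.Iio t)) (hxd : ∀ T, InDomain ψ (x T)) (k : ℕ) :
    ∫ ω, potential f ψ v θ₀ xs (centerPoint θ₀ (fun i =>
        (approxRun f ψ v τ (x fun j => S j ω) (fun j => S (t + j) ω) i).x) k) ∂P ≤
      ∫ ω, potential f ψ v θ₀ xs (x fun j => S j ω) ∂P := by
  have hW := totalWeight_pos A.theta_pos A.theta_le_one k
  have i1 := fun i => integrable_of_dependsOn (P := P) hS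
    ((dependsOn_approxRun_x_of_le (f := f) (ψ := ψ) (v := v) (τ := τ) hx
      (le_refl i)).comp_left (potential f ψ v θ₀ xs))
  have i2 := integrable_of_dependsOn (P := P) hS
    ((dependsOn_centerPoint (θ₀ := θ₀) (f := f) (ψ := ψ) (v := v) (τ := τ) (k := k)
      hx).comp_left (potential f ψ v θ₀ xs))
  refine le_of_mul_le_mul_left ?_ hW
  rw [← integral_const_mul]
  have i3 : Integrable (fun ω => ∑ i ∈ Finset.range k, gammaCoeff θ₀ k i * invThetaPrevSq θ₀ i *
      potential f ψ v θ₀ xs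
        (approxRun f ψ v τ (x fun j => S j ω) (fun j => S (t + j) ω) i).x) P :=
    integrable_finsetSum _ fun i _ => (i1 i).const_mul _
  refine (integral_mono (i2.const_mul _) (i3.add ((i1 k).const_mul (lastWeight θ₀ k)))
    fun ω => (totalWeight_mul_centerPoint_le A A.convexOn_potential
      fun i _ => approxRun_x_mem A (hxd _) _ i).2).trans ?_
  rw [integral_add' i3 ((i1 k).const_mul _), integral_finsetSum _ fun i _ => (i1 i).const_mul _,
    integral_const_mul, totalWeight, add_mul, Finset.sum_mul]
  refine add_le_add (Finset.sum_le_sum fun i _ => ?_)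
    (mul_le_mul_of_nonneg_left (integral_potential_run_le A hS hind hlaw hx hxd k)
      (lastWeight_pos A.theta_pos k).le)
  rw [integral_const_mul]
  exact mul_le_mul_of_nonneg_left (integral_potential_run_le A hS hind hlaw hx hxd i)
    (mul_nonneg (gammaCoeff_nonneg A.theta_pos A.theta_le_one k i)
      (invThetaPrevSq_nonneg A.theta_pos A.theta_le_one i))

theorem integral_potential_restartPoint_le_combo (A : ApproxSetting f ψ v q xs τ θ₀)
    (hS : ∀ k, Measurable (S k))
    (hx : DependsOn x (Set.Iio t)) (hxd : ∀ T, InDomain ψ (x T)) (k : ℕ) {σ : ℝ} (hσ0 : 0 ≤ σ)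
    (hσ1 : σ ≤ 1) :
    ∫ ω, potential f ψ v θ₀ xs (restartPoint θ₀ σ (fun i =>
        (approxRun f ψ v τ (x fun j => S j ω) (fun j => S (t + j) ω) i).x) k) ∂P ≤
      σ * ∫ ω, potential f ψ v θ₀ xs
        (approxRun f ψ v τ (x fun j => S j ω) (fun j => S (t + j) ω) k).x ∂P
      + (1 - σ) * ∫ ω, potential f ψ v θ₀ xs (centerPoint θ₀ (fun i =>
        (approxRun f ψ v τ (x fun j => S j ω) (fun j => S (t + j) ω) i).x) k) ∂P := by
  have i1 := integrable_of_dependsOn (P := P) hS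
    ((dependsOn_approxRun_x_of_le (f := f) (ψ := ψ) (v := v) (τ := τ) hx
      (le_refl k)).comp_left (potential f ψ v θ₀ xs))
  have i2 := integrable_of_dependsOn (P := P) hS
    ((dependsOn_centerPoint (θ₀ := θ₀) (f := f) (ψ := ψ) (v := v) (τ := τ) (k := k)
      hx).comp_left (potential f ψ v θ₀ xs))
  have i3 := integrable_of_dependsOn (P := P) hS
    ((dependsOn_restartPoint (θ₀ := θ₀) (σ := σ) (f := f) (ψ := ψ) (v := v) (τ := τ) (k := k)
      hx).comp_left (potential f ψ v θ₀ xs))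
  rw [← integral_const_mul, ← integral_const_mul, ← integral_add (i1.const_mul _) (i2.const_mul _)]
  exact integral_mono i3 ((i1.const_mul _).add (i2.const_mul _)) fun ω =>
    A.convexOn_potential.2 (approxRun_x_mem A (hxd _) _ k) (centerPoint_run_mem A (hxd _) _ k)
      hσ0 (sub_nonneg.2 hσ1) (by ring)

/-- Needs no growth condition. It handles the restart after iteration `0` when `r = 0`, where the
run has length one. -/
theorem integral_potential_restartPoint_le (A : ApproxSetting f ψ v q xs τ θ₀)
    (hS : ∀ k, Measurable (S k))
    (hind : iIndepFun S P) (hlaw : ∀ k T, P.real {ω | S k ω = T} = (q T).toReal)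
    (hx : DependsOn x (Set.Iio t)) (hxd : ∀ T, InDomain ψ (x T)) (k : ℕ) {σ : ℝ} (hσ0 : 0 ≤ σ)
    (hσ1 : σ ≤ 1) :
    ∫ ω, potential f ψ v θ₀ xs (restartPoint θ₀ σ (fun i =>
        (approxRun f ψ v τ (x fun j => S j ω) (fun j => S (t + j) ω) i).x) k) ∂P ≤
      ∫ ω, potential f ψ v θ₀ xs (x fun j => S j ω) ∂P := by
  have h1 := mul_le_mul_of_nonneg_left (integral_potential_run_le A hS hind hlaw hx hxd k) hσ0
  have h2 := mul_le_mul_of_nonneg_left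
    (integral_potential_centerPoint_le A hS hind hlaw hx hxd k) (sub_nonneg.2 hσ1)
  have h3 := integral_potential_restartPoint_le_combo (P := P) A hS hx hxd k hσ0 hσ1
  linarith

/-- The factor by which a restart after `k` iterations decreases the expected potential. -/
noncomputable def restartFactor (θ₀ : ℝ) (k : ℕ) (μ μF : ℝ) : ℝ :=
  1 - min (mCoeff θ₀ k μ) (mCoeff θ₀ k μF) / (1 + mCoeff θ₀ k μ)

/-- Let `d`, `a`, `b` be the expected potentials at the start, at the last iterate and at the center
point, and `m`, `m_F` the coefficients for `μ`, `μF`. Growth gives `a + m_F b ≤ d`, and convexity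
gives `b ≤ d`. Using the first for the part `m' = min(m, m_F)` of `m` and the second for the rest
bounds `(a + m b)/(1 + m)`. -/
theorem integral_potential_restartPoint_le_factor (A : ApproxSetting f ψ v q xs τ θ₀)
    {μF : ℝ} (hμF : 0 < μF)
    (hgrowth : ∀ x, objective f ψ xs + ((μF / 2 * weightedSq v (x - xs) : ℝ) : WithTop ℝ)
      ≤ objective f ψ x)
    (hS : ∀ k, Measurable (S k))
    (hind : iIndepFun S P) (hlaw : ∀ k T, P.real {ω | S k ω = T} = (q T).toReal)
    (hx : DependsOn x (Set.Iio t)) (hxd : ∀ T, InDomain ψ (x T)) {k : ℕ} (hk : 1 ≤ k) {μ : ℝ}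
    (hμ : 0 < μ) :
    ∫ ω, potential f ψ v θ₀ xs (restartPoint θ₀ (1 / (1 + mCoeff θ₀ k μ)) (fun i =>
        (approxRun f ψ v τ (x fun j => S j ω) (fun j => S (t + j) ω) i).x) k) ∂P ≤
      restartFactor θ₀ k μ μF * ∫ ω, potential f ψ v θ₀ xs (x fun j => S j ω) ∂P := by
  have hm := mCoeff_pos A.theta_pos A.theta_le_one hμ k
  have hmF := mCoeff_pos A.theta_pos A.theta_le_one hμF k
  have hσ0 : 0 ≤ 1 / (1 + mCoeff θ₀ k μ) := by positivity
  have hσ1 : 1 / (1 + mCoeff θ₀ k μ) ≤ 1 := by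
    rw [div_le_one (by positivity)]
    linarith
  have h1 := integral_potential_add_gap_le A hS hind hlaw hx hxd hk
  have h2 := integral_potential_centerPoint_le A hS hind hlaw hx hxd k
  have h3 := integral_potential_restartPoint_le_combo (P := P) A hS hx hxd k hσ0 hσ1
  have i2 := integrable_of_dependsOn (P := P) hS
    ((dependsOn_centerPoint (θ₀ := θ₀) (f := f) (ψ := ψ) (v := v) (τ := τ) (k := k)
      hx).comp_left (potential f ψ v θ₀ xs))
  have i3 := integrable_of_dependsOn (P := P) hS
    ((dependsOn_centerPoint (θ₀ := θ₀) (f := f) (ψ := ψ) (v := v) (τ := τ) (k := k)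
      hx).comp_left fun y => objectiveGap f ψ y xs)
  have hD : ∀ y, InDomain ψ y →
      potential f ψ v θ₀ xs y ≤ (1 / μF + (1 - θ₀)) * objectiveGap f ψ y xs := by
    intro y hy
    have h := hgrowth y
    rw [hy.objective_eq, A.min_mem.objective_eq, ← WithTop.coe_add, WithTop.coe_le_coe] at h
    have hle : 1 / 2 * weightedSq v (y - xs) ≤ 1 / μF * objectiveGap f ψ y xs := by
      rw [objectiveGap_eq hy A.min_mem, one_div_mul_eq_div μF, le_div_iff₀ hμF]
      linarith
    rw [potential]
    linarith
  have h4 : mCoeff θ₀ k μF * ∫ ω, potential f ψ v θ₀ xs (centerPoint θ₀ (fun i =>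
        (approxRun f ψ v τ (x fun j => S j ω) (fun j => S (t + j) ω) i).x) k) ∂P ≤
      θ₀ ^ 2 * totalWeight θ₀ k * ∫ ω, objectiveGap f ψ (centerPoint θ₀ (fun i =>
        (approxRun f ψ v τ (x fun j => S j ω) (fun j => S (t + j) ω) i).x) k) xs ∂P := by
    rw [← integral_const_mul, ← integral_const_mul]
    refine integral_mono (i2.const_mul _) (i3.const_mul _) fun ω => ?_
    refine (mul_le_mul_of_nonneg_left (hD _ (centerPoint_run_mem A (hxd _) _ k)) hmF.le).trans
      (le_of_eq ?_)
    have : 0 < 1 / μF + (1 - θ₀) := by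
      have := A.theta_le_one
      have : 0 < 1 / μF := by positivity
      linarith
    rw [← mul_assoc, mCoeff_eq hμF, div_mul_cancel₀ _ this.ne']
  set a := ∫ ω, potential f ψ v θ₀ xs
        (approxRun f ψ v τ (x fun j => S j ω) (fun j => S (t + j) ω) k).x ∂P
  set b := ∫ ω, potential f ψ v θ₀ xs (centerPoint θ₀ (fun i =>
        (approxRun f ψ v τ (x fun j => S j ω) (fun j => S (t + j) ω) i).x) k) ∂P with hb
  set d := ∫ ω, potential f ψ v θ₀ xs (x fun j => S j ω) ∂P
  have hb0 : 0 ≤ b := integral_nonneg fun ω =>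
    A.potential_nonneg (centerPoint_run_mem A (hxd _) _ k)
  refine h3.trans ?_
  rw [restartFactor]
  set m := mCoeff θ₀ k μ
  set m' := min m (mCoeff θ₀ k μF) with hm'
  have e1 : m' * b ≤ mCoeff θ₀ k μF * b := mul_le_mul_of_nonneg_right (min_le_right _ _) hb0
  have e2 : (m - m') * b ≤ (m - m') * d :=
    mul_le_mul_of_nonneg_left h2 (sub_nonneg.2 (min_le_left _ _))
  -- This is where the value of `σ` enters: the center point gets `m` times the weight of the last
  -- iterate.
  have e3 : 1 / (1 + m) * a + (1 - 1 / (1 + m)) * b = (a + m * b) / (1 + m) := by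
    field_simp
    ring
  have e4 : (1 - m' / (1 + m)) * d = (d + (m - m') * d) / (1 + m) := by
    field_simp
    ring
  rw [e3, e4]
  exact div_le_div_of_nonneg_right (by linarith) (by positivity)

end Expectation

/-! ### Splitting the restarted algorithm into runs -/

section Restart

variable {n : ℕ} {f : EuclideanSpace ℝ (Fin n) → ℝ} {ψ : Fin n → ℝ → WithTop ℝ}
  {v : Fin n → ℝ} {q : PMF (Finset (Fin n))} {xs : EuclideanSpace ℝ (Fin n)} {τ θ₀ σ : ℝ}
  {K r : ℕ} {x₀ : EuclideanSpace ℝ (Fin n)}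

theorem dependsOn_restartedState (k : ℕ) :
    DependsOn (fun T => restartedState f ψ v τ σ K r x₀ T k) (Set.Iio k) := by
  induction k with
  | zero => exact fun _ _ _ => rfl
  | succ k ih =>
    intro T T' h
    have h1 : restartedState f ψ v τ σ K r x₀ T k = restartedState f ψ v τ σ K r x₀ T' k :=
      ih fun i hi => h i (by simp at hi ⊢; omega)
    simp only [restartedState, h1, h k (by simp)]

theorem dependsOn_restartedIterate (k : ℕ) :
    DependsOn (fun T => restartedIterate f ψ v τ σ K r x₀ T k) (Set.Iio k) :=
  (dependsOn_restartedState k).comp_left ApproxState.x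

/-- As long as no restart occurs, restarted APPROX runs like APPROX. -/
theorem restartedState_add (T : ℕ → Finset (Fin n)) {t : ℕ} {x : EuclideanSpace ℝ (Fin n)}
    (ht : restartedState f ψ v τ σ K r x₀ T t = ApproxState.start x) {k : ℕ}
    (hk : ∀ j < k, ¬ t + j ≡ r [MOD K]) :
    restartedState f ψ v τ σ K r x₀ T (t + k) = approxRun f ψ v τ x (fun j => T (t + j)) k := by
  induction k with
  | zero => exact ht
  | succ k ih =>
    rw [← add_assoc, restartedState, if_neg (hk k (by omega)), ih fun j hj => hk j (by omega)]
    rfl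

theorem restartedState_add_restart (A : ApproxSetting f ψ v q xs τ θ₀)
    (T : ℕ → Finset (Fin n)) {t : ℕ} {x : EuclideanSpace ℝ (Fin n)}
    (ht : restartedState f ψ v τ σ K r x₀ T t = ApproxState.start x) {k : ℕ}
    (hk : ∀ j < k, ¬ t + j ≡ r [MOD K]) (hr : t + k ≡ r [MOD K]) :
    restartedState f ψ v τ σ K r x₀ T (t + (k + 1)) = ApproxState.start (restartPoint θ₀ σ
      (fun i => (approxRun f ψ v τ x (fun j => T (t + j)) i).x) (k + 1)) := by
  rw [← add_assoc, restartedState, if_pos hr, restartedState_add T ht hk]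
  have h : approxStep f ψ v τ (T (t + k)) (approxRun f ψ v τ x (fun j => T (t + j)) k) =
      approxRun f ψ v τ x (fun j => T (t + j)) (k + 1) := rfl
  simp only [h, approxRun_age, ← A.theta_eq]
  exact congrArg _ (restartPoint_congr fun i hi => approxRun_hist _ _ hi)

variable {Ω : Type*} [MeasurableSpace Ω] {P : Measure Ω} {S : ℕ → Ω → Finset (Fin n)} {t : ℕ}
  {c : ℝ}

/-- At time `t`, restarted APPROX starts afresh at a point of the domain, whose expected potential
is at most `c`. -/
def FreshStart (f : EuclideanSpace ℝ (Fin n) → ℝ) (ψ : Fin n → ℝ → WithTop ℝ) (v : Fin n → ℝ)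
    (τ θ₀ σ : ℝ) (K r : ℕ) (x₀ xs : EuclideanSpace ℝ (Fin n)) (P : Measure Ω)
    (S : ℕ → Ω → Finset (Fin n)) (t : ℕ) (c : ℝ) : Prop :=
  (∀ T, restartedState f ψ v τ σ K r x₀ T t =
    ApproxState.start (restartedIterate f ψ v τ σ K r x₀ T t)) ∧
  (∀ T, InDomain ψ (restartedIterate f ψ v τ σ K r x₀ T t)) ∧
  ∫ ω, potential f ψ v θ₀ xs (restartedIterate f ψ v τ σ K r x₀ (fun j => S j ω) t) ∂P ≤ c

theorem FreshStart.iterate_add [IsProbabilityMeasure P]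
    (A : ApproxSetting f ψ v q xs τ θ₀)
    (hS : ∀ k, Measurable (S k))
    (hind : iIndepFun S P) (hlaw : ∀ k T, P.real {ω | S k ω = T} = (q T).toReal)
    (h : FreshStart f ψ v τ θ₀ σ K r x₀ xs P S t c) {k : ℕ}
    (hk : ∀ j < k, ¬ t + j ≡ r [MOD K]) :
    (∀ T, InDomain ψ (restartedIterate f ψ v τ σ K r x₀ T (t + k))) ∧
    ∫ ω, potential f ψ v θ₀ xs
      (restartedIterate f ψ v τ σ K r x₀ (fun j => S j ω) (t + k)) ∂P ≤ c := by
  obtain ⟨h1, h2, h3⟩ := h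
  have e : ∀ T, restartedIterate f ψ v τ σ K r x₀ T (t + k) =
      (approxRun f ψ v τ (restartedIterate f ψ v τ σ K r x₀ T t) (fun j => T (t + j)) k).x :=
    fun T => congrArg ApproxState.x (restartedState_add T (h1 T) hk)
  constructor
  · intro T
    rw [e]
    exact approxRun_x_mem A (h2 T) _ _
  · simp only [e]
    exact (integral_potential_run_le A hS hind hlaw (dependsOn_restartedIterate t) h2 k).trans h3

theorem FreshStart.restart (A : ApproxSetting f ψ v q xs τ θ₀)
    (h : FreshStart f ψ v τ θ₀ σ K r x₀ xs P S t c) {k : ℕ}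
    (hk : ∀ j < k, ¬ t + j ≡ r [MOD K]) (hr : t + k ≡ r [MOD K]) (hσ0 : 0 ≤ σ) (hσ1 : σ ≤ 1)
    {c' : ℝ} (hc : ∫ ω, potential f ψ v θ₀ xs (restartPoint θ₀ σ (fun i =>
        (approxRun f ψ v τ (restartedIterate f ψ v τ σ K r x₀ (fun j => S j ω) t)
          (fun j => S (t + j) ω) i).x) (k + 1)) ∂P ≤ c') :
    FreshStart f ψ v τ θ₀ σ K r x₀ xs P S (t + (k + 1)) c' := by
  obtain ⟨h1, h2, h3⟩ := h
  have e1 := fun T => restartedState_add_restart A T (h1 T) hk hr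
  have e2 : ∀ T, restartedIterate f ψ v τ σ K r x₀ T (t + (k + 1)) = restartPoint θ₀ σ
      (fun i => (approxRun f ψ v τ (restartedIterate f ψ v τ σ K r x₀ T t)
        (fun j => T (t + j)) i).x) (k + 1) :=
    fun T => congrArg ApproxState.x (e1 T)
  refine ⟨fun T => ?_, fun T => ?_, ?_⟩
  · rw [e1, e2]
  · rw [e2]
    exact restartPoint_run_mem A (h2 T) _ _ hσ0 hσ1
  · simp only [e2]
    exact hc

end Restart

/-! ### The times of the restarts -/

section Period

variable {K r t₀ : ℕ}

/-- Full runs begin at the times `t₀ + p * K`, and a restart occurs only at their end. -/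
theorem modEq_iff_of_period (hK : 2 ≤ K) (ht : r = 0 ∧ t₀ = 1 ∨ r + 1 = K ∧ t₀ = 0) (p j : ℕ)
    (hj : j < K) : t₀ + p * K + j ≡ r [MOD K] ↔ j + 1 = K := by
  have h1 : t₀ + p * K + j ≡ t₀ + j [MOD K] := by
    have : t₀ + p * K + j = t₀ + j + K * p := by ring
    rw [this]
    exact Nat.add_modulus_mul_modEq_iff.2 rfl
  have h2 : t₀ + p * K + j ≡ r [MOD K] ↔ t₀ + j ≡ r [MOD K] :=
    ⟨fun h => h1.symm.trans h, fun h => h1.trans h⟩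
  rw [h2]
  -- For `r = 0` iteration `0` already triggers a restart, so full runs begin at time `1`; for `r =
  -- K - 1` they begin at time `0`.
  rcases ht with ⟨rfl, rfl⟩ | ⟨hr, rfl⟩
  · rw [Nat.modEq_zero_iff_dvd]
    constructor
    · intro h
      have := Nat.le_of_dvd (by omega) h
      omega
    · rintro rfl
      rw [add_comm]
  · rw [zero_add, Nat.ModEq, Nat.mod_eq_of_lt hj, Nat.mod_eq_of_lt (by omega)]
    omega

end Period

/-! ### Geometric decay of the expected potential -/

section Rate

variable {n : ℕ} {f : EuclideanSpace ℝ (Fin n) → ℝ} {ψ : Fin n → ℝ → WithTop ℝ}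
  {v : Fin n → ℝ} {q : PMF (Finset (Fin n))} {xs : EuclideanSpace ℝ (Fin n)} {τ θ₀ : ℝ}
  {K r t₀ : ℕ} {x₀ : EuclideanSpace ℝ (Fin n)} {Ω : Type*} [MeasurableSpace Ω] {P : Measure Ω}
  [IsProbabilityMeasure P] {S : ℕ → Ω → Finset (Fin n)} {μ μF : ℝ}

theorem restartFactor_nonneg (h0 : 0 < θ₀) (h1 : θ₀ ≤ 1) (hμ : 0 < μ) :
    0 ≤ restartFactor θ₀ K μ μF := by
  have hm := mCoeff_pos h0 h1 hμ K
  rw [restartFactor, sub_nonneg, div_le_one (by positivity)]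
  exact (min_le_left _ _).trans (by linarith)

theorem freshStart_of_period (A : ApproxSetting f ψ v q xs τ θ₀) (hμF : 0 < μF)
    (hgrowth : ∀ x, objective f ψ xs + ((μF / 2 * weightedSq v (x - xs) : ℝ) : WithTop ℝ)
      ≤ objective f ψ x)
    (hS : ∀ k, Measurable (S k))
    (hind : iIndepFun S P) (hlaw : ∀ k T, P.real {ω | S k ω = T} = (q T).toReal)
    (hμ : 0 < μ) (hx₀ : InDomain ψ x₀) (hK : 2 ≤ K)
    (ht : r = 0 ∧ t₀ = 1 ∨ r + 1 = K ∧ t₀ = 0) (p : ℕ) :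
    FreshStart f ψ v τ θ₀ (1 / (1 + mCoeff θ₀ K μ)) K r x₀ xs P S (t₀ + p * K)
      (restartFactor θ₀ K μ μF ^ p * potential f ψ v θ₀ xs x₀) := by
  have hm := mCoeff_pos A.theta_pos A.theta_le_one hμ K
  have hσ0 : 0 ≤ 1 / (1 + mCoeff θ₀ K μ) := by positivity
  have hσ1 : 1 / (1 + mCoeff θ₀ K μ) ≤ 1 := by
    rw [div_le_one (by positivity)]
    linarith
  induction p with
  | zero =>
    have hstart : FreshStart f ψ v τ θ₀ (1 / (1 + mCoeff θ₀ K μ)) K r x₀ xs P S 0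
        (potential f ψ v θ₀ xs x₀) := by
      refine ⟨fun T => rfl, fun T => hx₀, ?_⟩
      simp [restartedIterate, restartedState, ApproxState.x, ApproxState.start]
    rw [pow_zero, one_mul, zero_mul, add_zero]
    rcases ht with ⟨rfl, rfl⟩ | ⟨hr, rfl⟩
    · refine hstart.restart A (k := 0) (by simp) rfl hσ0 hσ1 ?_
      exact (integral_potential_restartPoint_le A hS hind hlaw (dependsOn_restartedIterate 0)
        hstart.2.1 1 hσ0 hσ1).trans hstart.2.2
    · exact hstart
  | succ p ih =>
    obtain ⟨k, rfl⟩ : ∃ k, K = k + 1 := ⟨K - 1, by omega⟩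
    have e : t₀ + (p + 1) * (k + 1) = t₀ + p * (k + 1) + (k + 1) := by ring
    rw [e]
    refine ih.restart A (fun j hj => ?_) ?_ hσ0 hσ1 ?_
    · rw [modEq_iff_of_period hK ht p j (by omega)]
      omega
    · rw [modEq_iff_of_period hK ht p k (by omega)]
    · refine (integral_potential_restartPoint_le_factor A hμF hgrowth hS hind hlaw
        (dependsOn_restartedIterate _) ih.2.1 (by omega) hμ).trans ?_
      rw [pow_succ', mul_assoc]
      exact mul_le_mul_of_nonneg_left ih.2.2
        (restartFactor_nonneg A.theta_pos A.theta_le_one hμ)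

/-- The expected potential decays geometrically in the number of full runs. -/
theorem integral_potential_restartedIterate_le (A : ApproxSetting f ψ v q xs τ θ₀) (hμF : 0 < μF)
    (hgrowth : ∀ x, objective f ψ xs + ((μF / 2 * weightedSq v (x - xs) : ℝ) : WithTop ℝ)
      ≤ objective f ψ x)
    (hS : ∀ k, Measurable (S k))
    (hind : iIndepFun S P) (hlaw : ∀ k T, P.real {ω | S k ω = T} = (q T).toReal)
    (hμ : 0 < μ) (hx₀ : InDomain ψ x₀) (hK : 2 ≤ K) (hr : r = 0 ∨ r + 1 = K) (k : ℕ) :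
    (∀ T, InDomain ψ (restartedIterate f ψ v τ (1 / (1 + mCoeff θ₀ K μ)) K r x₀ T k)) ∧
    ∃ p : ℕ, (k : ℝ) / K - 1 ≤ p ∧ ∫ ω, potential f ψ v θ₀ xs
      (restartedIterate f ψ v τ (1 / (1 + mCoeff θ₀ K μ)) K r x₀ (fun j => S j ω) k) ∂P ≤
        restartFactor θ₀ K μ μF ^ p * potential f ψ v θ₀ xs x₀ := by
  have hK0 : (0 : ℝ) < K := by positivity
  obtain ⟨t₀, ht⟩ : ∃ t₀, r = 0 ∧ t₀ = 1 ∨ r + 1 = K ∧ t₀ = 0 := by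
    rcases hr with h | h
    · exact ⟨1, Or.inl ⟨h, rfl⟩⟩
    · exact ⟨0, Or.inr ⟨h, rfl⟩⟩
  have ht1 : t₀ ≤ 1 := by omega
  rcases lt_or_ge k t₀ with hk | hk
  · obtain rfl : k = 0 := by omega
    refine ⟨fun T => hx₀, 0, by simp, ?_⟩
    simp [restartedIterate, restartedState, ApproxState.x, ApproxState.start]
  · have hdiv := Nat.div_add_mod (k - t₀) K
    have hmod := Nat.mod_lt (k - t₀) (show 0 < K by omega)
    set p := (k - t₀) / K
    set j := (k - t₀) % K
    have hkj : k = t₀ + p * K + j := by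
      rw [mul_comm p]
      omega
    have h := (freshStart_of_period A hμF hgrowth hS hind hlaw hμ hx₀ hK ht p).iterate_add
      A hS hind hlaw (k := j) fun i hi => by
        rw [modEq_iff_of_period hK ht p i (by omega)]
        omega
    rw [← hkj] at h
    refine ⟨h.1, p, ?_, h.2⟩
    -- A possible initial run of one iteration and an incomplete last run of at most `K - 1`
    -- iterations together cost at most one period.
    have : (k : ℝ) ≤ (p + 1) * K := by
      have : k ≤ (p + 1) * K := by
        rw [hkj, add_mul]
        omega
      exact_mod_cast this
    rw [sub_le_iff_le_add, div_le_iff₀ hK0]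
    exact this

end Rate

/-! ### From geometric decay to the iteration bound -/

section IterationBound

variable {θ₀ μ μF : ℝ}

theorem sqrt_three_mul_sqrt_le (hμ : 0 < μ) (hμ1 : μ ≤ 1) :
    √3 * √(1 + 1 / μ) ≤ √6 * (1 / √μ) := by
  have h : 1 ≤ 1 / μ := by rw [le_div_iff₀ hμ]; linarith
  have e : 1 / √μ = √(1 / μ) := by rw [Real.sqrt_div zero_le_one, Real.sqrt_one]
  rw [e, ← Real.sqrt_mul (by norm_num), ← Real.sqrt_mul (by norm_num)]
  exact Real.sqrt_le_sqrt (by linarith)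

theorem two_le_sqrt_three_mul_sqrt (hμ : 0 < μ) (hμ1 : μ ≤ 1) :
    2 ≤ √3 * √(1 + 1 / μ) := by
  have h : 1 ≤ 1 / μ := by rw [le_div_iff₀ hμ]; linarith
  rw [← Real.sqrt_mul (by norm_num)]
  exact Real.le_sqrt_of_sq_le (by linarith)

/-- The term `-2/θ₀` is at most `-2`, so it absorbs both the `+1` and the rounding up. -/
theorem period_bounds (h0 : 0 < θ₀) (h1 : θ₀ ≤ 1) (hμ : 0 < μ) (hμ1 : μ ≤ 1) {K : ℕ}
    (hK : K = ⌈2 * √3 / θ₀ * √(1 + 1 / μ) - 2 / θ₀ + 1⌉₊) :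
    2 ≤ K ∧ K ≤ 1 / θ₀ * (2 * √3 * √(1 + 1 / μ)) := by
  have h2 := two_le_sqrt_three_mul_sqrt hμ hμ1
  have hi : 1 ≤ 1 / θ₀ := by rw [le_div_iff₀ h0]; linarith
  have e : 2 * √3 / θ₀ * √(1 + 1 / μ) - 2 / θ₀ + 1 =
      1 / θ₀ * (2 * (√3 * √(1 + 1 / μ)) - 2) + 1 := by ring
  have hpos : 1 ≤ 1 / θ₀ * (2 * (√3 * √(1 + 1 / μ)) - 2) :=
    one_le_mul_of_one_le_of_one_le hi (by linarith)
  rw [e] at hK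
  constructor
  · have h := Nat.le_ceil (1 / θ₀ * (2 * (√3 * √(1 + 1 / μ)) - 2) + 1)
    rw [← hK] at h
    have : (2 : ℝ) ≤ K := by linarith
    exact_mod_cast this
  · have h := Nat.ceil_lt_add_one (show 0 ≤ 1 / θ₀ * (2 * (√3 * √(1 + 1 / μ)) - 2) + 1 by linarith)
    rw [← hK] at h
    linarith

/-- With `s = min(1, μF/μ)` one has `m(μF) ≥ s m(μ)`, and `m(μ)/(1 + m(μ)) ≥ 1/3` with room to spare
once `m(μ) ≥ 1`. -/
theorem restartFactor_le {K : ℕ} (h0 : 0 < θ₀) (h1 : θ₀ ≤ 1) (hμ : 0 < μ) (hμF : 0 < μF)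
    (hm : 1 ≤ mCoeff θ₀ K μ) : restartFactor θ₀ K μ μF ≤ 1 - min 1 (μF / μ) / 3 := by
  have hs : 0 < min 1 (μF / μ) := lt_min one_pos (div_pos hμF hμ)
  have hW : 0 < θ₀ ^ 2 * totalWeight θ₀ K := mul_pos (by positivity) (totalWeight_pos h0 h1 K)
  have hd : 0 ≤ 1 - θ₀ := by linarith
  have hF : min 1 (μF / μ) * mCoeff θ₀ K μ ≤ mCoeff θ₀ K μF := by
    rw [mCoeff_eq hμ, mCoeff_eq hμF, ← mul_div_assoc,
      div_le_div_iff₀ (by positivity) (by positivity)]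
    have e1 : min 1 (μF / μ) * (1 / μF) ≤ 1 / μ := by
      refine (mul_le_mul_of_nonneg_right (min_le_right _ _) (by positivity)).trans (le_of_eq ?_)
      field_simp
    have e2 : min 1 (μF / μ) * (1 - θ₀) ≤ 1 - θ₀ := mul_le_of_le_one_left hd (min_le_left _ _)
    have e3 : min 1 (μF / μ) * (1 / μF + (1 - θ₀)) ≤ 1 / μ + (1 - θ₀) := by linarith
    have := mul_le_mul_of_nonneg_left e3 hW.le
    linarith
  have hle : min 1 (μF / μ) * mCoeff θ₀ K μ ≤ min (mCoeff θ₀ K μ) (mCoeff θ₀ K μF) :=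
    le_min (mul_le_of_le_one_left (by linarith) (min_le_left _ _)) hF
  rw [restartFactor]
  refine sub_le_sub_left ?_ 1
  rw [div_le_div_iff₀ (by norm_num) (by linarith)]
  have := mul_le_mul_of_nonneg_left hm hs.le
  linarith

/-- After the prescribed number of iterations, the geometric decay reaches the accuracy `ε`. -/
theorem restartFactor_pow_mul_le {n : ℕ} {τ D ε : ℝ} {K k p : ℕ} (h0 : 0 < θ₀) (h1 : θ₀ ≤ 1)
    (hθ : θ₀ = τ / n) (hμ : 0 < μ) (hμ1 : μ ≤ 1) (hμF : 0 < μF)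
    (hK : K = ⌈2 * √3 / θ₀ * √(1 + 1 / μ) - 2 / θ₀ + 1⌉₊) (hD : 0 ≤ D) (hε : 0 < ε)
    (hk : iterationBound n τ μ μF D ε ≤ k) (hp : (k : ℝ) / K - 1 ≤ p) :
    restartFactor θ₀ K μ μF ^ p * D ≤ ε := by
  have hm := one_le_mCoeff h0 h1 hμ hμ1 (hK ▸ Nat.le_ceil _)
  obtain ⟨hK2, hKle⟩ := period_bounds h0 h1 hμ hμ1 hK
  have hρ0 := restartFactor_nonneg (K := K) (μF := μF) h0 h1 hμ
  have hρ := restartFactor_le h0 h1 hμ hμF hm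
  have hs : 0 < min 1 (μF / μ) := lt_min one_pos (div_pos hμF hμ)
  -- If `D ≤ ε` the logarithm may be nonpositive or `D` zero, but then a factor in `[0, 1]`
  -- suffices.
  rcases le_or_gt D ε with hDε | hDε
  · exact (mul_le_of_le_one_left hD (pow_le_one₀ hρ0 (by linarith))).trans hDε
  have hD0 : 0 < D := hε.trans hDε
  have hl : 0 < Real.log (D / ε) := Real.log_pos (by rwa [one_lt_div hε])
  have hKpos : (0 : ℝ) < K := by positivity
  have hsμ : 0 < √μ := Real.sqrt_pos.2 hμ
  set s := min 1 (μF / μ) with hsdef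
  set M := max (1 / √μ) (√μ / μF) with hM
  -- `M √μ = max(1, μ/μF)` is the reciprocal of `s`, so the maximum in the bound compensates a
  -- misjudged `μ`.
  have hsM : 1 ≤ s * (M * √μ) := by
    have e1 : 1 ≤ M * √μ := by
      have := mul_le_mul_of_nonneg_right (le_max_left (1 / √μ) (√μ / μF)) hsμ.le
      rwa [one_div_mul_cancel hsμ.ne'] at this
    have e2 : μ / μF ≤ M * √μ := by
      have := mul_le_mul_of_nonneg_right (le_max_right (1 / √μ) (√μ / μF)) hsμ.le
      rwa [div_mul_eq_mul_div, Real.mul_self_sqrt hμ.le] at this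
    rcases min_choice 1 (μF / μ) with h | h
    · rw [hsdef, h, one_mul]
      exact e1
    · rw [hsdef, h]
      calc (1 : ℝ) = μF / μ * (μ / μF) := by field_simp
        _ ≤ _ := by gcongr
  have hKM : K ≤ 1 / θ₀ * (2 * √6 * (1 / √μ)) := by
    refine hKle.trans (mul_le_mul_of_nonneg_left ?_ (by positivity))
    have := sqrt_three_mul_sqrt_le hμ hμ1
    linarith
  -- The constant `6√6` is `3 · 2√6`: the `3` from the contraction factor, `2√6` from the bound on
  -- `K`. The additive term of the iteration bound covers the one period lost in `k/K - 1`.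
  have hpl : 3 * (M * √μ) * Real.log (D / ε) ≤ p := by
    refine le_trans ?_ hp
    rw [le_sub_iff_add_le, le_div_iff₀ hKpos]
    refine le_trans ?_ hk
    have hc : 0 ≤ 3 * (M * √μ) * Real.log (D / ε) := by
      have : 0 < M := lt_max_of_lt_left (by positivity)
      positivity
    have h3 := mul_le_mul_of_nonneg_left hKM hc
    have e : 3 * (M * √μ) * Real.log (D / ε) * (1 / θ₀ * (2 * √6 * (1 / √μ))) =
        1 / θ₀ * (6 * √6 * M * Real.log (D / ε)) := by
      field_simp
      ring
    have hn : (n : ℝ) / τ = 1 / θ₀ := by rw [hθ, one_div_div]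
    rw [iterationBound, hn, ← hM]
    linarith
  have hlog : Real.log (D / ε) ≤ s / 3 * p := by
    have h3 := mul_le_mul_of_nonneg_left hpl (show 0 ≤ s / 3 by positivity)
    have h4 := mul_le_mul_of_nonneg_right hsM hl.le
    linarith
  calc restartFactor θ₀ K μ μF ^ p * D ≤ Real.exp (-(s / 3)) ^ p * D := by
        gcongr
        have := Real.add_one_le_exp (-(s / 3))
        linarith
    _ = Real.exp (-(s / 3 * p)) * D := by
        rw [← Real.exp_nat_mul]
        congr 2
        ring
    _ ≤ Real.exp (-Real.log (D / ε)) * D := by gcongr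
    _ = ε := by
        rw [Real.exp_neg, Real.exp_log (by positivity)]
        field_simp

theorem sqrt_six_le : √6 ≤ 5 / 2 := Real.sqrt_le_iff.2 (by norm_num)

theorem iterationBound_le {n : ℕ} {τ D ε : ℝ} (hnτ : 0 ≤ (n : ℝ) / τ) (hμ : 0 < μ) (hμ1 : μ ≤ 1)
    (hD : 0 ≤ D) (hε : 0 < ε) (hε1 : ε ≤ 1 / 2) :
    iterationBound n τ μ μF D ε ≤ 40 * (n / τ * max (1 / √μ) (√μ / μF) *
      (Real.log (1 / ε) + max 0 (Real.log D))) := by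
  have hsμ : 0 < √μ := Real.sqrt_pos.2 hμ
  have hM1 : 1 / √μ ≤ max (1 / √μ) (√μ / μF) := le_max_left _ _
  set M := max (1 / √μ) (√μ / μF)
  have hM : 0 < M := lt_of_lt_of_le (by positivity) hM1
  -- The restriction `ε ≤ 1/2` keeps the logarithm away from `0`, so that the additive term can be
  -- absorbed.
  have hL : 1 / 2 ≤ Real.log (1 / ε) := by
    have h := Real.log_le_log (by norm_num)
      (show 2 ≤ 1 / ε by rw [le_div_iff₀ hε]; linarith)
    have := Real.log_two_gt_d9
    linarith
  have hl : Real.log (D / ε) ≤ Real.log (1 / ε) + max 0 (Real.log D) := by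
    rcases hD.eq_or_lt with rfl | hD
    · simp only [zero_div, Real.log_zero, max_self]
      linarith
    · rw [Real.log_div hD.ne' hε.ne', one_div, Real.log_inv]
      have := le_max_right 0 (Real.log D)
      linarith
  set L := Real.log (1 / ε) + max 0 (Real.log D)
  have hL' : 1 / 2 ≤ L := by
    have := le_max_left 0 (Real.log D)
    linarith
  have h6 := sqrt_six_le
  have h1 : 6 * √6 * M * Real.log (D / ε) ≤ 15 * (M * L) := by
    calc 6 * √6 * M * Real.log (D / ε) ≤ 6 * √6 * M * L := by gcongr
      _ ≤ 6 * (5 / 2) * M * L := by gcongr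
      _ = _ := by ring
  have h2 : 2 * √3 * √(1 + 1 / μ) ≤ 5 * M := by
    have h := sqrt_three_mul_sqrt_le hμ hμ1
    have : √6 * (1 / √μ) ≤ 5 / 2 * M := by gcongr
    linarith
  have h3 : M * (1 / 2) ≤ M * L := by gcongr
  have h4 : 6 * √6 * M * Real.log (D / ε) + 2 * √3 * √(1 + 1 / μ) ≤ 40 * (M * L) := by
    have : 0 ≤ M * L := by positivity
    linarith
  refine (mul_le_mul_of_nonneg_left h4 hnτ).trans (le_of_eq ?_)
  ring

theorem isBigOWith_iterationBound {n : ℕ} {τ : ℝ} (D : ℝ) (hnτ : 0 ≤ (n : ℝ) / τ) (hμ : 0 < μ)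
    (hμ1 : μ ≤ 1) :
    IsBigOWith 40 (𝓝[>] (0 : ℝ)) (fun ε => iterationBound n τ μ μF D ε)
      (fun ε => n / τ * max (1 / √μ) (√μ / μF) * Real.log (1 / ε)) := by
  have hsμ : 0 < √μ := Real.sqrt_pos.2 hμ
  have hM1 : 1 / √μ ≤ max (1 / √μ) (√μ / μF) := le_max_left _ _
  rw [isBigOWith_iff]
  -- For such small `ε`, `log(1/ε) ≥ |log D| + 1`, which absorbs the dependence on `D`.
  filter_upwards [Real.tendsto_log_nhdsGT_zero.eventually_le_atBot (-(|Real.log D| + 1)),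
    self_mem_nhdsWithin] with ε hε hε0
  have hε0 : 0 < ε := hε0
  set M := max (1 / √μ) (√μ / μF)
  have hM : 0 < M := lt_of_lt_of_le (by positivity) hM1
  have e : Real.log (1 / ε) = -Real.log ε := by rw [one_div, Real.log_inv]
  set L := Real.log (1 / ε)
  have habs := abs_nonneg (Real.log D)
  have hL : 1 ≤ L := by linarith
  have hl : |Real.log (D / ε)| ≤ 2 * L := by
    rcases eq_or_ne D 0 with rfl | hD
    · simp only [zero_div, Real.log_zero, abs_zero]
      linarith
    · rw [Real.log_div hD hε0.ne', sub_eq_add_neg, ← e]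
      refine (abs_add_le _ _).trans ?_
      rw [abs_of_pos (show 0 < L by linarith)]
      linarith
  have h6 := sqrt_six_le
  have h1 : |6 * √6 * M * Real.log (D / ε)| ≤ 30 * (M * L) := by
    rw [abs_mul, abs_of_nonneg (show 0 ≤ 6 * √6 * M by positivity)]
    calc 6 * √6 * M * |Real.log (D / ε)| ≤ 6 * (5 / 2) * M * (2 * L) := by gcongr
      _ = _ := by ring
  have h2 : |2 * √3 * √(1 + 1 / μ)| ≤ 5 * M := by
    rw [abs_of_nonneg (by positivity)]
    have h := sqrt_three_mul_sqrt_le hμ hμ1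
    have : √6 * (1 / √μ) ≤ 5 / 2 * M := by gcongr
    linarith
  have h3 : M * 1 ≤ M * L := by gcongr
  have h4 : |6 * √6 * M * Real.log (D / ε) + 2 * √3 * √(1 + 1 / μ)| ≤ 40 * (M * L) := by
    refine (abs_add_le _ _).trans ?_
    linarith
  rw [iterationBound, Real.norm_eq_abs, Real.norm_eq_abs, abs_mul, abs_of_nonneg hnτ,
    abs_of_nonneg (show 0 ≤ (n : ℝ) / τ * M * L by positivity)]
  refine (mul_le_mul_of_nonneg_left h4 hnτ).trans (le_of_eq ?_)
  ring

end IterationBound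

/-! ### The complexity theorem -/

theorem mainTheorem5 :
    ∃ C : ℝ, 0 < C ∧
      ∀ (n : ℕ) (f : EuclideanSpace ℝ (Fin n) → ℝ) (ψ : Fin n → ℝ → WithTop ℝ)
        (v : Fin n → ℝ) (q : PMF (Finset (Fin n))) (x₀ xs : EuclideanSpace ℝ (Fin n))
        (τ θ₀ μF μ σ : ℝ) (K r : ℕ)
        -- the composite problem, its minimizer and the growth condition
        (_hf_diff : Differentiable ℝ f) (_hf_conv : ConvexOn ℝ Set.univ f)
        (_hψ : ∀ i, IsClosedConvex (ψ i))
        (_hv : ∀ i, 0 < v i)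
        (_hxs : ∀ x, objective f ψ xs ≤ objective f ψ x)
        (_hμF : 0 < μF)
        (_hgrowth : ∀ x,
          objective f ψ xs + ((μF / 2 * weightedSq v (x - xs) : ℝ) : WithTop ℝ)
            ≤ objective f ψ x)
        -- the sampling
        (_hτ : τ = expectedSize q) (_hτ_pos : 0 < τ)
        (_hq : IsUniformSampling q) (_hESO : ESO f q v)
        -- the parameters of the algorithm
        (_hx₀ : separableSum ψ x₀ ≠ ⊤)
        (_hθ₀ : θ₀ = τ / n)
        (_hμ : 0 < μ) (_hμ_le : μ ≤ 1)
        (_hK : K = ⌈2 * √3 / θ₀ * √(1 + 1 / μ) - 2 / θ₀ + 1⌉₊)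
        (_hσ : σ = 1 / (1 + mCoeff θ₀ K μ))
        (_hr : r = 0 ∨ r + 1 = K)
        -- independent random sets of coordinates with law `q`
        (Ω : Type*) [MeasurableSpace Ω] (P : Measure Ω) [IsProbabilityMeasure P]
        (S : ℕ → Ω → Finset (Fin n))
        (_hS_meas : ∀ k, Measurable (S k))
        (_hS_law : ∀ k T, P {ω | S k ω = T} = q T)
        (_hS_indep : iIndepFun S P),
        -- the guarantee after the stated number of iterations
        (∀ ε : ℝ, 0 < ε → ∀ k : ℕ,
          iterationBound n τ μ μF (potential f ψ v θ₀ xs x₀) ε ≤ k →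
            (∀ ω, objective f ψ
                (restartedIterate f ψ v τ σ K r x₀ (fun j => S j ω) k) ≠ ⊤) ∧
            Integrable (fun ω => potential f ψ v θ₀ xs
                (restartedIterate f ψ v τ σ K r x₀ (fun j => S j ω) k)) P ∧
            ∫ ω, potential f ψ v θ₀ xs
                (restartedIterate f ψ v τ σ K r x₀ (fun j => S j ω) k) ∂P ≤ ε) ∧
        -- the order of this number of iterations, with a universal constant
        (∀ ε : ℝ, 0 < ε → ε ≤ 1 / 2 →
          iterationBound n τ μ μF (potential f ψ v θ₀ xs x₀) ε ≤
            C * (n / τ * max (1 / √μ) (√μ / μF) *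
              (Real.log (1 / ε) + max 0 (Real.log (potential f ψ v θ₀ xs x₀))))) ∧
        IsBigOWith C (𝓝[>] (0 : ℝ))
          (fun ε => iterationBound n τ μ μF (potential f ψ v θ₀ xs x₀) ε)
          (fun ε => n / τ * max (1 / √μ) (√μ / μF) * Real.log (1 / ε)) := by
  refine ⟨40, by norm_num, ?_⟩
  intro n f ψ v q x₀ xs τ θ₀ μF μ σ K r hfd hfc hψ hv hxs hμF hgrowth hτ hτ0 hq hE hx₀ hθ₀ hμ hμ1
    hK hσ hr Ω _ P _ S hS hlaw hind
  have hx₀' : InDomain ψ x₀ := separableSum_ne_top_iff.1 hx₀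
  -- Finiteness of `F(x⋆)` is not assumed; it follows from `F(x⋆) ≤ F(x₀) < ∞`.
  have hxs' : InDomain ψ xs := objective_ne_top_iff.1
    (ne_top_of_le_ne_top (objective_ne_top_iff.2 hx₀') (hxs x₀) : objective f ψ xs ≠ ⊤)
  have A : ApproxSetting f ψ v q xs τ θ₀ :=
    ⟨hfd, hfc, hψ, hv, hxs, hxs', hτ, hτ0, hθ₀, hq, hE⟩
  have hnτ : 0 ≤ (n : ℝ) / τ := div_nonneg (Nat.cast_nonneg n) hτ0.le
  have hlaw' : ∀ k T, P.real {ω | S k ω = T} = (q T).toReal := fun k T => by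
    rw [Measure.real, hlaw]
  have hD := A.potential_nonneg hx₀'
  refine ⟨fun ε hε k hk => ?_,
    fun ε hε hε1 => iterationBound_le hnτ hμ hμ1 hD hε hε1,
    isBigOWith_iterationBound _ hnτ hμ hμ1⟩
  have hK2 := (period_bounds A.theta_pos A.theta_le_one hμ hμ1 hK).1
  subst hσ
  obtain ⟨hdom, p, hp, hle⟩ := integral_potential_restartedIterate_le A hμF hgrowth hS hind hlaw'
    hμ hx₀' hK2 hr k
  refine ⟨fun ω => objective_ne_top_iff.2 (hdom _), ?_, hle.trans ?_⟩
  · exact integrable_of_dependsOn hS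
      ((dependsOn_restartedIterate k).comp_left (potential f ψ v θ₀ xs))
  · exact restartFactor_pow_mul_le A.theta_pos A.theta_le_one hθ₀ hμ hμ1 hμF hK hD hε hk hp
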